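/- A signed graph $\Sigma$ is a finite graph (loops and multiple edges allowed) with a sign $\operatorname{sgn}(e)\in\{+,-\}$ on each edge $e$. An orientation puts an arrow on each half-edge, pointing toward or away from its vertex, such that on a positive edge exactly one of the two arrows points toward its vertex, and on a negative edge both or neither do. A cycle is a closed walk (of positive length) such that every vertex of the walk has, among the arrows on the edges of the walk, at least one pointing toward it and at least one pointing away from it; an orientation without cycles is acyclic. A sink is a vertex with only arrows pointing toward it (possibly none). A coloring $\kappa:V(\Sigma)\to\mathbb Z$ is proper if $\kappa(u)\neq\operatorname{sgn}(e)\,\kappa(v)$ for every edge $e$ with endpoints $u,v$; it preserves the orientation in which the arrow of $e$ at $u$ points toward $u$ if and only if $\kappa(u)>\operatorname{sgn}(e)\,\kappa(v)$. In variables $(x_i)_{i\in\mathbb Z}$ put $x^\kappa=\prod_{v}x_{\kappa(v)}$, let $X_\Sigma=\sum_\kappa x^\kappa$ over all proper colorings of $\Sigma$, and for an acyclic orientation $P$ of a signed graph let $Y_P=\sum_\kappa x^\kappa$ over the proper colorings that preserve $P$. Let $\mathbb Y$ be the $\mathbb Q$-span of all $Y_P$, and let $p_{a,b}=\sum_{i\in\mathbb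 Z}x_i^a x_{-i}^b$ for $(a,b)\ne(0,0)$. The set $\{p_{a,b}: a\ge 1,\ b\ge 0\}\cup\{x_0\}$ is called the $p$-basis; since $p_{a,b}=p_{b,a}$, its elements are listed without repetition by the pairs with $a\geq 1$, $a\ge b\geq 0$, together with $x_0$. The space $\mathbb Y$ is closed under multiplication and contains $x_0$, all $p_{a,b}$ with $(a,b)\neq(0,0)$, and all $X_\Sigma$. There is a linear and multiplicative map $f:\mathbb Y\to\mathbb Q[\lambda]$ with $f(p_{a,b})=2\lambda+1$ for all $(a,b)\ne(0,0)$ and $f(x_0)=1$, and there is a unique linear map $\varphi:\mathbb Y\to\mathbb Q[t]$ such that $\varphi(Y_P)=t^{k}$ for every acyclic orientation $P$ with exactly $k$ sinks. Let $\Sigma$ be any signed graph with $n$ vertices. Then: 1. There is a unique polynomial $\chi_\Sigma\in\mathbb Q[\lambda]$ (the signed chromatic polynomial) such that, for every integer $\ell\ge 0$, $\chi_\Sigma(\ell)$ is the number of proper colorings of $\Sigma$ in the colors $-\ell,\dots,-1,0,1,\dots,\ell$; and $f(X_\Sigma)=\chi_\Sigma$ for every such $f$. 2. $$\chi_\Sigma(-1)=f(X_\Sigma)\big|_{\lambda=-1}=(-1)^n\,\varphi(X_\Sigma)\big|_{t=1}=(-1)^n\cdot\#\{\text{acyclic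 orientations of }\Sigma\}.$$ 3. $X_\Sigma$ can be written in exactly one way as a polynomial with rational coefficients in the elements of the $p$-basis, and the sum of the absolute values of the coefficients of that polynomial is the number of acyclic orientations of $\Sigma$. -/

import Mathlib

open Polynomial

noncomputable section

/-- A signed graph with vertex set `V` and edge set `E`; multiple edges and loops are allowed.
The two half-edges of an edge `e` are labelled (arbitrarily) by the Booleans, and `ends e s` is the
vertex at which the half-edge `(e, s)` is attached. -/
structure SignedGraph (V : Type*) (E : Type*) where
  ends : E → Bool → V
  sgn : E → ℤˣ

namespace SignedGraph

variable {V E : Type*}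

/-- An orientation puts an arrow on every half-edge; `toward e s = true` means that the arrow on the
half-edge `(e, s)` points toward its vertex, `false` that it points away from it.
On a positive edge the two arrows point in the same direction along the edge
(one toward its vertex, the other away from its vertex);
on a negative edge they point in opposite directions (both toward or both away). -/
@[ext] structure Orientation (S : SignedGraph V E) where
  toward : E → Bool → Bool
  positive : ∀ e, S.sgn e = 1 → toward e true ≠ toward e false
  negative : ∀ e, S.sgn e = -1 → toward e true = toward e false

/-- A closed walk of length `k + 1`, as a cyclic sequence of edges with a direction of travel:
step `(e, s)` goes from the vertex `ends e s` to the vertex `ends e (!s)`.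
(The index addition is modulo `k + 1`.) -/
def IsClosedWalk (S : SignedGraph V E) {k : ℕ} (w : Fin (k + 1) → E × Bool) : Prop :=
  ∀ i, S.ends (w i).1 (!(w i).2) = S.ends (w (i + 1)).1 (w (i + 1)).2

namespace Orientation

variable {S : SignedGraph V E}

/-- A cycle: a closed walk each of whose vertices has an arrow pointing toward it and
an arrow pointing away from it, among the arrows on the edges of the walk. -/
def IsCycle (P : S.Orientation) {k : ℕ} (w : Fin (k + 1) → E × Bool) : Prop :=
  S.IsClosedWalk w ∧ ∀ i,
    (∃ j s, S.ends (w j).1 s = S.ends (w i).1 (w i).2 ∧ P.toward (w j).1 s = true) ∧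
    (∃ j s, S.ends (w j).1 s = S.ends (w i).1 (w i).2 ∧ P.toward (w j).1 s = false)

def Acyclic (P : S.Orientation) : Prop :=
  ∀ (k : ℕ) (w : Fin (k + 1) → E × Bool), ¬ P.IsCycle w

/-- A sink: a vertex with only arrows pointing toward it. -/
def IsSink (P : S.Orientation) (v : V) : Prop :=
  ∀ e s, S.ends e s = v → P.toward e s = true

/-- The number of sinks. -/
def sinkCount (P : S.Orientation) : ℕ := Nat.card {v : V // P.IsSink v}

end Orientation

/-- The number of acyclic orientations. -/
def acyclicCount (S : SignedGraph V E) : ℕ := Nat.card {P : S.Orientation // P.Acyclic}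

/-- Proper colorings in colors from `ℤ`: `κ(u) ≠ sgn(e) κ(v)` for every edge `e : uv`. -/
def IsProper (S : SignedGraph V E) (κ : V → ℤ) : Prop :=
  ∀ e, κ (S.ends e true) ≠ (S.sgn e : ℤ) * κ (S.ends e false)

/-- A proper coloring preserves (induces) the orientation in which, for an edge `e : uv`,
the arrow at `u` points toward `u` exactly when `κ(u) > sgn(e) κ(v)`: in the
covering graph, lower colors point to higher colors. -/
def Orientation.IsPreservedBy {S : SignedGraph V E} (P : S.Orientation) (κ : V → ℤ) : Prop :=
  ∀ e s, P.toward e s = true ↔ (S.sgn e : ℤ) * κ (S.ends e (!s)) < κ (S.ends e s)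

end SignedGraph

/-- The formal power series `∑_{s} x^{mon s}` in variables indexed by `ℤ`, given coefficientwise
(meaningful when every monomial comes from finitely many `s`). -/
def formalSum {T : Type*} (mon : T → ℤ →₀ ℕ) : MvPowerSeries ℤ ℚ :=
  fun m => (Nat.card {s : T // mon s = m} : ℚ)

/-- The exponent of the monomial `x^κ = ∏_v x_{κ(v)}`. -/
def colorMonomial {V : Type*} [Fintype V] (κ : V → ℤ) : ℤ →₀ ℕ :=
  ∑ v, Finsupp.single (κ v) 1

namespace SignedGraph

variable {V E : Type*} [Fintype V]

/-- The chromatic B-symmetric function `X_Σ = ∑_κ x^κ`, over all proper colorings `κ`. -/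
def chromaticB (S : SignedGraph V E) : MvPowerSeries ℤ ℚ :=
  formalSum (fun κ : {κ : V → ℤ // S.IsProper κ} => colorMonomial κ.1)

/-- `Y_P = ∑_κ x^κ`, over all proper colorings `κ` that preserve `P`. -/
def Orientation.Y {S : SignedGraph V E} (P : S.Orientation) : MvPowerSeries ℤ ℚ :=
  formalSum (fun κ : {κ : V → ℤ // S.IsProper κ ∧ P.IsPreservedBy κ} => colorMonomial κ.1)

/-- `χ` is the signed chromatic polynomial of `S`: for every natural number `l`, the value `χ(l)` is
the number of proper colorings in the colors `-l, …, -1, 0, 1, …, l`. -/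
def IsSignedChromaticPolynomial (S : SignedGraph V E) (χ : ℚ[X]) : Prop :=
  ∀ l : ℕ, χ.eval (l : ℚ) =
    (Nat.card {κ : V → ℤ // S.IsProper κ ∧ ∀ v, -(l : ℤ) ≤ κ v ∧ κ v ≤ (l : ℤ)} : ℚ)

end SignedGraph

/-- The span of all the `Y_P`, for `P` a signed poset, that is, an acyclic orientation of a finite
signed graph (up to isomorphism with vertices `Fin n` and edges `Fin m`). -/
def signedPosetSpan : Submodule ℚ (MvPowerSeries ℤ ℚ) :=
  Submodule.span ℚ {F | ∃ (n m : ℕ) (S : SignedGraph (Fin n) (Fin m)) (P : S.Orientation),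
    P.Acyclic ∧ F = P.Y}

/-- `p_{a,b} = ∑_{i ∈ ℤ} x_i^a x_{-i}^b`, for `(a, b) ≠ (0, 0)`. -/
def powerSum (a b : ℕ) : MvPowerSeries ℤ ℚ :=
  formalSum (fun i : ℤ => Finsupp.single i a + Finsupp.single (-i) b)

/-- Linear and multiplicative maps `f` on the span of the `Y_P` with `f(p_{a,b}) = 2λ + 1` and
`f(x_0) = 1`; the variable of `ℚ[X]` is `λ`. -/
structure IsChromaticSpecialization (f : signedPosetSpan →ₗ[ℚ] ℚ[X]) : Prop where
  map_mul : ∀ F G : signedPosetSpan,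
    ∃ h : (F : MvPowerSeries ℤ ℚ) * G ∈ signedPosetSpan, f ⟨_, h⟩ = f F * f G
  map_powerSum : ∀ a b : ℕ, (a, b) ≠ (0, 0) →
    ∃ h : powerSum a b ∈ signedPosetSpan, f ⟨_, h⟩ = 2 * X + 1
  map_x_zero : ∃ h : MvPowerSeries.X 0 ∈ signedPosetSpan, f ⟨_, h⟩ = 1

/-- The sink counting function: the linear map `φ` with `φ(Y_P) = t^{sink(P)}` for all signed
posets `P`; the variable of `ℚ[X]` is `t`. -/
def IsSinkCounting (φ : signedPosetSpan →ₗ[ℚ] ℚ[X]) : Prop :=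
  ∀ (n m : ℕ) (S : SignedGraph (Fin n) (Fin m)) (P : S.Orientation), P.Acyclic →
    ∃ h : P.Y ∈ signedPosetSpan, φ ⟨_, h⟩ = X ^ P.sinkCount

/-- Indices of the p-basis: the pairs `(a, b)` with `a ≥ 1` and `a ≥ b` (as `p_{a,b} = p_{b,a}`,
each function `p_{a,b}` occurs exactly once), and `none` for `x_0`. -/
abbrev PIndex : Type := Option {ab : ℕ × ℕ // 1 ≤ ab.1 ∧ ab.2 ≤ ab.1}

/-- The p-basis `{p_{a,b}} ∪ {x_0}`. -/
def pBasis : PIndex → MvPowerSeries ℤ ℚ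
  | none => MvPowerSeries.X 0
  | some ab => powerSum ab.1.1 ab.1.2

end

/-!
A proper coloring `κ` that preserves an orientation `P` is an integer point of the open convex
cone cut out by one strict inequality `± κ(u) ± κ(v) > 0` for each edge `uv`, the signs being the
directions of the arrows. The cone has an integer point exactly when `P` is acyclic: a vertex of
largest `|κ|` excludes cycles, and conversely acyclicity provides vertices whose arrows all agree,
which can be colored one after the other with rapidly growing absolute values
(`Orientation.acyclic_iff_exists_compatible`). As each proper coloring preserves one orientation,
`X_Σ` is the sum of the `Y_P` over the acyclic orientations.

Sorting the colorings of `P` in the colors `-l, …, l` by the set of vertices of largest absolute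
value gives a recursion in `l`. Hence their number is a polynomial in `l`, the order polynomial,
and the recursion read at `l = -1` shows by induction that its value there is `(-1)^n`
(`Orientation.orderPolynomial_neg_one`): the sum over the admissible choices of extreme vertices
factors over the vertices, and the factor of a non-isolated extremal vertex is `1 - 1`.

The number of colorings in bounded colors is a finite sum of coefficients of `Y_P`, so sending
`Y_P` to its order polynomial respects the linear relations among the `Y_P`. This gives the
specialization `f`. For `φ`, the colors are bounded by `-l` and `l + 1`, with exactly `j` vertices
of the color `l + 1`. These vertices form an arbitrary set of `j` sinks, so the number of such
colorings is a sum of order polynomials, and its value at `l = -1` is, up to sign, the number of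
`j`-element sets of sinks. Thus the binomial coefficients of the numbers of sinks respect the
linear relations, and so do the powers of `t`.

The expansion in the p-basis comes from deletion and contraction on graphs with weighted vertices
(`exists_signsAlternate`). Each contraction removes a vertex and contributes a minus sign, so the
sign of a coefficient is `(-1)^(n - k)`, where `k` is the number of factors `p_{a,b}` of its
monomial. Since `f(p_{a,b}) = 2λ + 1` is `-1` at `λ = -1`, the sum of the absolute values is
`(-1)^n f(X_Σ)(-1)`, the number of acyclic orientations. Uniqueness is the algebraic independence
of the p-basis (`algebraicIndependent_pBasis`): the monomial `x_0^c ∏_j x_j^{a_j} x_{-j}^{b_j}`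
with `k` different indices `j` singles out the product `x_0^c ∏_j p_{a_j,b_j}` among all products
with at most `k` factors.
-/

/-! ### Formal sums of monomials -/

/-- Every monomial comes from finitely many indices, so that `formalSum mon` is not affected by the
convention that infinite sets have cardinality `0`. -/
def FiniteFibers {T : Type*} (mon : T → ℤ →₀ ℕ) : Prop := ∀ m, Finite {s : T // mon s = m}

theorem FiniteFibers.subtype {T : Type*} {mon : T → ℤ →₀ ℕ} (h : FiniteFibers mon)
    (p : T → Prop) : FiniteFibers (fun t : {t // p t} => mon t.1) := fun m =>
  have := h m
  Finite.of_injective (fun s : {s : {t // p t} // mon s.1 = m} =>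
    (⟨s.1.1, s.2⟩ : {s : T // mon s = m})) fun a b hab => by
      simpa [Subtype.ext_iff] using hab

theorem FiniteFibers.finite_le {T : Type*} {mon : T → ℤ →₀ ℕ} (h : FiniteFibers mon)
    (m : ℤ →₀ ℕ) : {s | mon s ≤ m}.Finite := by
  have : {s | mon s ≤ m} = ⋃ i ∈ Set.Iic m, {s | mon s = i} := by ext; simp
  rw [this]
  exact (Set.finite_Iic m).biUnion fun i _ => h i

theorem FiniteFibers.prod {T T' : Type*} {mon : T → ℤ →₀ ℕ} {mon' : T' → ℤ →₀ ℕ}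
    (h : FiniteFibers mon) (h' : FiniteFibers mon') :
    FiniteFibers (fun t : T × T' => mon t.1 + mon' t.2) := fun m => by
  refine ((h.finite_le m).prod (h'.finite_le m)).subset fun t ht => ?_
  have ht : mon t.1 + mon' t.2 = m := ht
  constructor
  · exact (ht ▸ le_self_add : mon t.1 ≤ m)
  · exact (ht ▸ le_add_self : mon' t.2 ≤ m)

@[simp] theorem coeff_formalSum {T : Type*} (mon : T → ℤ →₀ ℕ) (m : ℤ →₀ ℕ) :
    MvPowerSeries.coeff m (formalSum mon) = (Nat.card {s : T // mon s = m} : ℚ) := rfl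

theorem formalSum_equiv {T T' : Type*} {mon : T → ℤ →₀ ℕ} {mon' : T' → ℤ →₀ ℕ} (e : T ≃ T')
    (h : ∀ t, mon' (e t) = mon t) : formalSum mon = formalSum mon' := by
  ext m
  rw [coeff_formalSum, coeff_formalSum]
  congr 1
  exact Nat.card_congr (e.subtypeEquiv fun t => by rw [h])

theorem formalSum_eq_sum_fiber {T I : Type*} [Fintype I] {mon : T → ℤ →₀ ℕ}
    (hm : FiniteFibers mon) (q : T → I) :
    formalSum mon = ∑ i, formalSum (fun t : {t // q t = i} => mon t.1) := by
  ext m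
  have := hm m
  have (i : I) := hm.subtype (fun t => q t = i) m
  simp only [map_sum, coeff_formalSum]
  rw [← Nat.cast_sum, ← Nat.card_sigma]
  congr 1
  refine Nat.card_congr ⟨fun s => ⟨q s.1, ⟨s.1, rfl⟩, s.2⟩, fun s => ⟨s.2.1.1, s.2.2⟩, fun s => rfl, ?_⟩
  rintro ⟨_, ⟨s, rfl⟩, h⟩
  rfl

theorem formalSum_eq_add {T : Type*} {mon : T → ℤ →₀ ℕ} (hm : FiniteFibers mon) (p : T → Prop) :
    formalSum mon = formalSum (fun t : {t // p t} => mon t.1) +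
      formalSum (fun t : {t // ¬ p t} => mon t.1) := by
  classical
  rw [formalSum_eq_sum_fiber hm (fun t => decide (p t)), Fintype.sum_bool]
  congr 1 <;> exact formalSum_equiv (Equiv.subtypeEquivRight fun t => by simp) fun t => rfl

theorem formalSum_mul {T T' : Type*} {mon : T → ℤ →₀ ℕ} {mon' : T' → ℤ →₀ ℕ}
    (h : FiniteFibers mon) (h' : FiniteFibers mon') :
    formalSum mon * formalSum mon' = formalSum (fun t : T × T' => mon t.1 + mon' t.2) := by
  ext m
  have (i : ℤ →₀ ℕ) := h i
  have (i : ℤ →₀ ℕ) := h' i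
  classical
  rw [MvPowerSeries.coeff_mul, coeff_formalSum, ← Finset.sum_coe_sort]
  simp only [coeff_formalSum, ← Nat.cast_mul, ← Nat.card_prod]
  rw [← Nat.cast_sum, ← Nat.card_sigma]
  congr 1
  symm
  refine Nat.card_congr ⟨fun s => ⟨⟨(mon s.1.1, mon' s.1.2), by simpa using s.2⟩, ⟨s.1.1, rfl⟩,
    ⟨s.1.2, rfl⟩⟩, fun s => ⟨(s.2.1.1, s.2.2.1), ?_⟩, fun s => rfl, ?_⟩
  · obtain ⟨⟨⟨a, b⟩, hp⟩, ⟨s, hs⟩, ⟨t, ht⟩⟩ := s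
    simp only at hs ht ⊢
    rw [hs, ht]
    simpa using hp
  · rintro ⟨⟨⟨a, b⟩, hp⟩, ⟨s, hs⟩, ⟨t, ht⟩⟩
    simp only at hs ht
    subst hs ht
    rfl

theorem formalSum_of_isEmpty {T : Type*} [IsEmpty T] (mon : T → ℤ →₀ ℕ) : formalSum mon = 0 := by
  ext m
  simp

theorem formalSum_unique {T : Type*} [Unique T] (mon : T → ℤ →₀ ℕ) :
    formalSum mon = MvPowerSeries.monomial (mon default) 1 := by
  classical
  ext m
  rw [coeff_formalSum, MvPowerSeries.coeff_monomial]
  split_ifs with h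
  · subst h
    rw [Nat.cast_eq_one, Nat.card_eq_one_iff_unique]
    exact ⟨inferInstance, ⟨⟨default, rfl⟩⟩⟩
  · have : IsEmpty {s : T // mon s = m} := ⟨fun s => h (by rw [← s.2, Unique.eq_default s.1])⟩
    simp

/-- A finite linear combination of coefficients, as a linear functional on power series. -/
noncomputable def weightedCoeffSum (B : Finset (ℤ →₀ ℕ)) (ω : (ℤ →₀ ℕ) → ℚ) :
    MvPowerSeries ℤ ℚ →ₗ[ℚ] ℚ :=
  ∑ m ∈ B, ω m • (MvPowerSeries.coeff m : MvPowerSeries ℤ ℚ →ₗ[ℚ] ℚ)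

theorem weightedCoeffSum_formalSum {T : Type*} (B : Finset (ℤ →₀ ℕ)) (ω : (ℤ →₀ ℕ) → ℚ)
    (mon : T → ℤ →₀ ℕ) (T₀ : Finset T) (hT₀ : ∀ t, t ∈ T₀ ↔ mon t ∈ B) :
    weightedCoeffSum B ω (formalSum mon) = ∑ t ∈ T₀, ω (mon t) := by
  classical
  have hmap : ∀ t ∈ T₀, mon t ∈ B := fun t ht => (hT₀ t).1 ht
  rw [← Finset.sum_fiberwise_of_maps_to hmap]
  simp only [weightedCoeffSum, LinearMap.sum_apply, LinearMap.smul_apply, coeff_formalSum,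
    smul_eq_mul]
  refine Finset.sum_congr rfl fun m hm => ?_
  rw [Finset.sum_congr rfl (g := fun _ => ω m) fun t ht => by rw [(Finset.mem_filter.1 ht).2],
    Finset.sum_const, nsmul_eq_mul, mul_comm]
  congr 2
  rw [← Nat.card_eq_finsetCard]
  refine Nat.card_congr (Equiv.subtypeEquivRight fun t => ?_)
  rw [Finset.mem_filter, hT₀]
  exact ⟨fun h => ⟨h ▸ hm, h⟩, fun h => h.2⟩

/-- The exponents with support in `I` and all entries at most `N`. -/
noncomputable def monomialBox (I : Finset ℤ) (N : ℕ) : Finset (ℤ →₀ ℕ) :=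
  I.finsupp fun _ => Finset.range (N + 1)

theorem mem_monomialBox {I : Finset ℤ} {N : ℕ} {m : ℤ →₀ ℕ} :
    m ∈ monomialBox I N ↔ m.support ⊆ I ∧ ∀ i, m i ≤ N := by
  rw [monomialBox, Finset.mem_finsupp_iff]
  refine and_congr_right fun h => ⟨fun h' i => ?_, fun h' i _ => by
    simpa [Nat.lt_succ_iff] using h' i⟩
  by_cases hi : i ∈ I
  · simpa [Nat.lt_succ_iff] using h' i hi
  · have : m i = 0 := by
      by_contra h0
      exact hi (h (Finsupp.mem_support_iff.2 h0))
    omega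

section ColorMonomial

variable {V : Type*} [Fintype V]

theorem colorMonomial_apply [DecidableEq V] (κ : V → ℤ) (i : ℤ) :
    colorMonomial κ i = (Finset.univ.filter fun v => κ v = i).card := by
  classical
  simp [colorMonomial, Finsupp.finsetSum_apply, Finsupp.single_apply]

theorem mem_support_colorMonomial (κ : V → ℤ) (i : ℤ) :
    i ∈ (colorMonomial κ).support ↔ ∃ v, κ v = i := by
  classical
  rw [Finsupp.mem_support_iff, colorMonomial_apply, Ne, Finset.card_eq_zero,
    Finset.filter_eq_empty_iff]
  simp

theorem colorMonomial_mem_monomialBox {κ : V → ℤ} {I : Finset ℤ} {N : ℕ}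
    (hN : Fintype.card V ≤ N) : colorMonomial κ ∈ monomialBox I N ↔ ∀ v, κ v ∈ I := by
  classical
  rw [mem_monomialBox]
  constructor
  · rintro ⟨h, -⟩ v
    exact h ((mem_support_colorMonomial κ _).2 ⟨v, rfl⟩)
  · refine fun h => ⟨fun i hi => ?_, fun i => ?_⟩
    · obtain ⟨v, rfl⟩ := (mem_support_colorMonomial κ i).1 hi
      exact h v
    · rw [colorMonomial_apply]
      exact (Finset.card_le_univ _).trans hN

theorem degree_colorMonomial (κ : V → ℤ) : (colorMonomial κ).degree = Fintype.card V := by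
  simp [colorMonomial]

theorem colorMonomial_comp_equiv {V' : Type*} [Fintype V'] (e : V' ≃ V) (κ : V → ℤ) :
    colorMonomial (κ ∘ e) = colorMonomial κ :=
  e.sum_comp fun v => Finsupp.single (κ v) 1

theorem finiteFibers_colorMonomial : FiniteFibers (colorMonomial : (V → ℤ) → ℤ →₀ ℕ) := fun m => by
  classical
  refine Finite.of_injective (β := V → {i // i ∈ m.support})
    (fun κ v => ⟨κ.1 v, by
      have h := (mem_support_colorMonomial κ.1 (κ.1 v)).2 ⟨v, rfl⟩
      have h' := κ.2
      exact (congrArg (κ.1 v ∈ Finsupp.support ·) h').mp h⟩) ?_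
  intro κ κ' h
  ext v
  simpa using congrArg Subtype.val (congrFun h v)

end ColorMonomial

/-! ### Orientations, colorings, and acyclicity -/

namespace SignedGraph

variable {V E : Type*} {S : SignedGraph V E}

namespace Orientation

/-- The direction of the arrow on a half-edge as a sign: `1` toward the vertex, `-1` away from it. -/
def arrow (P : S.Orientation) (e : E) (s : Bool) : ℤ := if P.toward e s then 1 else -1

/-- The linear form attached to an oriented edge `uv`: with the signs of the arrows at `u` and `v`
as coefficients, it is positive at `κ` exactly when `κ` is proper at the edge and preserves its
orientation. -/
def form (P : S.Orientation) (κ : V → ℤ) (e : E) : ℤ :=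
  P.arrow e true * κ (S.ends e true) + P.arrow e false * κ (S.ends e false)

/-- The proper colorings that preserve `P` are the integer points of an open convex cone. -/
def Compatible (P : S.Orientation) (κ : V → ℤ) : Prop := ∀ e, 0 < P.form κ e

theorem arrow_eq_or (P : S.Orientation) (e : E) (s : Bool) : P.arrow e s = 1 ∨ P.arrow e s = -1 := by
  unfold arrow
  split_ifs <;> simp

theorem form_eq (P : S.Orientation) (κ : V → ℤ) (e : E) (s : Bool) :
    P.form κ e = P.arrow e s * κ (S.ends e s) + P.arrow e (!s) * κ (S.ends e (!s)) := by
  cases s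
  · exact add_comm _ _
  · rfl

theorem isProper_and_isPreservedBy_iff (P : S.Orientation) (κ : V → ℤ) :
    S.IsProper κ ∧ P.IsPreservedBy κ ↔ P.Compatible κ := by
  unfold IsProper IsPreservedBy Compatible form arrow
  rw [← forall_and]
  refine forall_congr' fun e => ?_
  have hp := P.positive e
  have hn := P.negative e
  rw [Bool.forall_bool]
  rcases Int.units_eq_one_or (S.sgn e) with h | h
  · have hp := hp h
    cases h1 : P.toward e true <;> cases h2 : P.toward e false <;> simp_all <;> omega
  · have hn := hn h
    cases h1 : P.toward e true <;> cases h2 : P.toward e false <;> simp_all <;> omega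

/-- The orientation induced by a proper coloring. -/
def ofColoring (κ : V → ℤ) (h : S.IsProper κ) : S.Orientation where
  toward e s := decide ((S.sgn e : ℤ) * κ (S.ends e (!s)) < κ (S.ends e s))
  positive e he := by
    have := h e
    simp only [he, Units.val_one, one_mul, Bool.not_true, Bool.not_false, ne_eq,
      decide_eq_decide] at this ⊢
    omega
  negative e he := by
    have := h e
    simp only [he, Units.val_neg, Units.val_one, Bool.not_true, Bool.not_false,
      decide_eq_decide]
    omega

theorem isPreservedBy_iff_eq_ofColoring (P : S.Orientation) {κ : V → ℤ} (h : S.IsProper κ) :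
    P.IsPreservedBy κ ↔ ofColoring κ h = P := by
  unfold IsPreservedBy
  rw [Orientation.ext_iff, funext_iff]
  refine forall_congr' fun e => ?_
  rw [funext_iff]
  refine forall_congr' fun s => ?_
  simp only [ofColoring]
  rw [Bool.eq_iff_iff (b := P.toward e s), decide_eq_true_iff]
  exact Iff.comm

/-- The edge `e` lies inside the set `W` of vertices. -/
def _root_.SignedGraph.EdgeIn (S : SignedGraph V E) (W : Finset V) (e : E) : Prop :=
  ∀ s, S.ends e s ∈ W

/-- All arrows at `v` on edges inside `W` have the direction `d`. -/
def IsExtremal (P : S.Orientation) (W : Finset V) (v : V) (d : ℤ) : Prop :=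
  ∀ e s, S.EdgeIn W e → S.ends e s = v → P.arrow e s = d

/-- Every set of vertices with an edge inside has a vertex, not isolated in it, at which the arrows
all point the same way. For a finite graph this is equivalent to acyclicity. -/
def Peelable (P : S.Orientation) : Prop :=
  ∀ W : Finset V, (∃ e, S.EdgeIn W e) →
    ∃ e s d, S.EdgeIn W e ∧ (d = 1 ∨ d = -1) ∧ P.IsExtremal W (S.ends e s) d

/-- If no vertex is extremal, then a walk can always leave a vertex along an arrow opposite to the
one along which it arrived; a walk that does so eventually closes up to a cycle. -/
theorem Acyclic.peelable [Finite E] {P : S.Orientation} (hP : P.Acyclic) : P.Peelable := by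
  intro W hW
  by_contra! hcon
  have hnext : ∀ x : {x : E × Bool // S.EdgeIn W x.1}, ∃ y : {x : E × Bool // S.EdgeIn W x.1},
      S.ends y.1.1 y.1.2 = S.ends x.1.1 (!x.1.2) ∧
        P.toward y.1.1 y.1.2 = !P.toward x.1.1 (!x.1.2) := by
    rintro ⟨⟨e, s⟩, he⟩
    have h := hcon e (!s) (P.arrow e (!s)) he (P.arrow_eq_or e _)
    unfold IsExtremal at h
    push Not at h
    obtain ⟨e', s', he', hv, hne⟩ := h
    refine ⟨⟨(e', s'), he'⟩, hv, ?_⟩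
    unfold arrow at hne
    revert hne
    cases P.toward e' s' <;> cases P.toward e (!s) <;> simp
  choose f hf using hnext
  obtain ⟨e₀, he₀⟩ := hW
  -- a periodic point of `f` exists, since there are finitely many half-edges
  obtain ⟨i, j, hij, hfe⟩ : ∃ i j : ℕ, i < j ∧ f^[i] ⟨(e₀, true), he₀⟩ = f^[j] ⟨(e₀, true), he₀⟩ := by
    obtain ⟨i, j, hne, h⟩ := Finite.exists_ne_map_eq_of_infinite
      (fun n : ℕ => f^[n] ⟨(e₀, true), he₀⟩)
    rcases lt_or_gt_of_ne hne with h' | h'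
    · exact ⟨i, j, h', h⟩
    · exact ⟨j, i, h', h.symm⟩
  set x := f^[i] ⟨(e₀, true), he₀⟩ with hx
  obtain ⟨k, rfl⟩ := Nat.exists_eq_add_of_lt hij
  have hper : f^[k + 1] x = x := by
    rw [hx, ← Function.iterate_add_apply, show k + 1 + i = i + k + 1 by omega, ← hfe]
  have hstep : ∀ a : Fin (k + 1), f (f^[a.val] x) = f^[(a + 1).val] x := by
    intro a
    rw [← Function.iterate_succ_apply' f, Fin.val_add_one]
    split_ifs with h
    · rw [h]
      simpa using hper
    · rfl
  refine hP k (fun a => (f^[a.val] x).1) ⟨fun a => ?_, fun a => ?_⟩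
  · beta_reduce
    rw [← hstep]
    exact (hf _).1.symm
  · obtain ⟨b, rfl⟩ : ∃ b, b + 1 = a := ⟨a - 1, sub_add_cancel a 1⟩
    obtain ⟨h1, h2⟩ := hf (f^[b.val] x)
    rw [hstep] at h1 h2
    cases h : P.toward (f^[b.val] x).1.1 (!(f^[b.val] x).1.2)
    · exact ⟨⟨b + 1, _, rfl, by rw [h2, h]; rfl⟩, ⟨b, _, h1.symm, h⟩⟩
    · exact ⟨⟨b, _, h1.symm, h⟩, ⟨b + 1, _, rfl, by rw [h2, h]; rfl⟩⟩

/-- Colors are chosen one vertex at a time: an extremal vertex gets a color of the sign of its arrows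
whose absolute value exceeds those of all others. -/
theorem Peelable.exists_compatible [Fintype V] {P : S.Orientation} (hP : P.Peelable) :
    ∃ κ, P.Compatible κ := by
  classical
  suffices h : ∀ W : Finset V, ∃ κ : V → ℤ, ∀ e, S.EdgeIn W e → 0 < P.form κ e by
    obtain ⟨κ, hκ⟩ := h Finset.univ
    exact ⟨κ, fun e => hκ e fun s => Finset.mem_univ _⟩
  intro W
  induction W using Finset.strongInduction with
  | H W ih =>
    by_cases hW : ∃ e, S.EdgeIn W e
    · obtain ⟨e₀, s₀, d, he₀, hd, hext⟩ := hP W hW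
      set v := S.ends e₀ s₀ with hv
      obtain ⟨κ, hκ⟩ := ih (W.erase v) (Finset.erase_ssubset (he₀ s₀))
      set M : ℤ := 1 + ∑ u, |κ u| with hM
      have hMκ : ∀ u, |κ u| < M := fun u => by
        have := Finset.single_le_sum (f := fun u => |κ u|) (fun u _ => abs_nonneg _)
          (Finset.mem_univ u)
        omega
      refine ⟨Function.update κ v (d * M), fun e he => ?_⟩
      by_cases hex : ∃ s, S.ends e s = v
      · obtain ⟨s, hs⟩ := hex
        have hM0 : 0 < M := lt_of_le_of_lt (abs_nonneg _) (hMκ v)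
        have hd2 : d * d = 1 := by rcases hd with rfl | rfl <;> rfl
        rw [P.form_eq _ _ s, hs, hext e s he hs, Function.update_self, ← mul_assoc, hd2, one_mul]
        by_cases hs' : S.ends e (!s) = v
        · rw [hs', hext e (!s) he hs', Function.update_self, ← mul_assoc, hd2]
          omega
        · rw [Function.update_of_ne hs']
          have := abs_lt.1 (hMκ (S.ends e (!s)))
          rcases P.arrow_eq_or e (!s) with h | h <;> rw [h] <;> omega
      · push Not at hex
        have := hκ e fun s => Finset.mem_erase.2 ⟨hex s, he s⟩
        rw [form] at this ⊢
        rwa [Function.update_of_ne (hex _), Function.update_of_ne (hex _)]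
    · push Not at hW
      exact ⟨0, fun e he => (hW e he).elim⟩

/-- In a cycle, at a vertex of largest `|κ|`, one of the arrows gives an edge that violates
compatibility. -/
theorem Compatible.acyclic {P : S.Orientation} {κ : V → ℤ} (hκ : P.Compatible κ) : P.Acyclic := by
  rintro k w ⟨hw, hcyc⟩
  obtain ⟨i, hi⟩ := Finite.exists_max (fun i => |κ (S.ends (w i).1 (w i).2)|)
  have hall : ∀ j s, |κ (S.ends (w j).1 s)| ≤ |κ (S.ends (w i).1 (w i).2)| := by
    intro j s
    by_cases hs : s = (w j).2
    · exact hs ▸ hi j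
    · have hs : s = !(w j).2 := by cases s <;> cases h : (w j).2 <;> simp_all
      rw [hs, hw j]
      exact hi _
  have key : ∀ j s, S.ends (w j).1 s = S.ends (w i).1 (w i).2 →
      0 < P.arrow (w j).1 s * κ (S.ends (w i).1 (w i).2) := by
    intro j s hs
    have h1 := hκ (w j).1
    rw [P.form_eq _ _ s, hs] at h1
    have h2 := hall j (!s)
    by_contra! h3
    have h4 : ∀ x : ℤ, |P.arrow (w j).1 s * x| = |x| := fun x => by
      rcases P.arrow_eq_or (w j).1 s with h | h <;> simp [h]
    have h5 : ∀ x : ℤ, P.arrow (w j).1 (!s) * x ≤ |x| := fun x => by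
      rcases P.arrow_eq_or (w j).1 (!s) with h | h <;> simp [h, le_abs_self, neg_le_abs]
    have h6 := h4 (κ (S.ends (w i).1 (w i).2))
    rw [abs_of_nonpos h3] at h6
    have := h5 (κ (S.ends (w j).1 !s))
    omega
  obtain ⟨⟨j, s, hs, ht⟩, ⟨j', s', hs', ht'⟩⟩ := hcyc i
  have h1 := key j s hs
  have h2 := key j' s' hs'
  simp only [arrow, ht, ht', if_true] at h1 h2
  simp at h1 h2
  omega

theorem acyclic_iff_exists_compatible [Fintype V] [Finite E] {P : S.Orientation} :
    P.Acyclic ↔ ∃ κ, P.Compatible κ :=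
  ⟨fun h => h.peelable.exists_compatible, fun ⟨_, h⟩ => h.acyclic⟩

end Orientation

end SignedGraph

/-! ### Counting compatible colorings in a bounded range of colors -/

/-- Discrete antidifferentiation of polynomials, from Faulhaber's formula. -/
theorem exists_polynomial_of_forall_succ_sub {g : ℕ → ℚ} {r : ℚ[X]}
    (h : ∀ l : ℕ, g (l + 1) - g l = r.eval (l : ℚ)) :
    ∃ p : ℚ[X], ∀ l : ℕ, p.eval (l : ℚ) = g l := by
  have hsum : ∃ q : ℚ[X], ∀ l : ℕ, q.eval (l : ℚ) = ∑ k ∈ Finset.range l, r.eval (k : ℚ) := by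
    clear h
    induction r using Polynomial.induction_on' with
    | add r s hr hs =>
      obtain ⟨q, hq⟩ := hr
      obtain ⟨q', hq'⟩ := hs
      exact ⟨q + q', fun l => by simp [hq, hq', Finset.sum_add_distrib]⟩
    | monomial n a =>
      refine ⟨C a * ∑ i ∈ Finset.range (n + 1),
        C (_root_.bernoulli i * ((n + 1).choose i) / (n + 1)) * X ^ (n + 1 - i), fun l => ?_⟩
      simp only [eval_monomial, ← Finset.mul_sum, sum_range_pow, eval_mul, eval_C,
        eval_finsetSum, eval_pow, eval_X]
      congr 1
      exact Finset.sum_congr rfl fun i _ => by ring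
  obtain ⟨q, hq⟩ := hsum
  refine ⟨C (g 0) + q, fun l => ?_⟩
  rw [eval_add, eval_C, hq, ← Finset.sum_congr rfl fun k _ => h k, Finset.sum_range_sub]
  ring

theorem Polynomial.eq_of_forall_eval_natCast {p q : ℚ[X]}
    (h : ∀ l : ℕ, p.eval (l : ℚ) = q.eval (l : ℚ)) : p = q :=
  Polynomial.eq_of_infinite_eval_eq p q <|
    (Set.infinite_range_of_injective Nat.cast_injective).mono (by rintro _ ⟨l, rfl⟩; exact h l)

namespace SignedGraph.Orientation

variable {V E : Type*} {S : SignedGraph V E}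

open Classical in
/-- The signs that the color of `v` may have when its absolute value is the largest one in use;
`0` stands for a color of smaller absolute value. -/
noncomputable def extremalSigns (P : S.Orientation) (W : Finset V) (v : V) : Finset ℤ :=
  insert 0 (({1, -1} : Finset ℤ).filter fun d => v ∈ W ∧ P.IsExtremal W v d)

theorem mem_extremalSigns {P : S.Orientation} {W : Finset V} {v : V} {d : ℤ} :
    d ∈ P.extremalSigns W v ↔ d = 0 ∨ (d = 1 ∨ d = -1) ∧ v ∈ W ∧ P.IsExtremal W v d := by
  simp [extremalSigns]

variable [Fintype V]

open Classical in
/-- The compatible colorings of the subgraph induced on `W` in the colors `-l, …, l`, extended by `0`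
to all vertices. -/
noncomputable def boundedColorings (P : S.Orientation) (W : Finset V) (l : ℕ) : Finset (V → ℤ) :=
  (Fintype.piFinset fun v => if v ∈ W then Finset.Icc (-(l : ℤ)) l else {0}).filter
    fun κ => ∀ e, S.EdgeIn W e → 0 < P.form κ e

theorem mem_boundedColorings {P : S.Orientation} {W : Finset V} {l : ℕ} {κ : V → ℤ} :
    κ ∈ P.boundedColorings W l ↔ (∀ v ∈ W, -(l : ℤ) ≤ κ v ∧ κ v ≤ l) ∧ (∀ v ∉ W, κ v = 0) ∧
      ∀ e, S.EdgeIn W e → 0 < P.form κ e := by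
  classical
  simp only [boundedColorings, Finset.mem_filter, Fintype.mem_piFinset]
  rw [← and_assoc]
  refine and_congr_left fun _ => ⟨fun h => ⟨fun v hv => ?_, fun v hv => ?_⟩, fun h v => ?_⟩
  · simpa [hv] using h v
  · simpa [hv] using h v
  · split_ifs with hv
    · simpa using h.1 v hv
    · simpa using h.2 v hv

/-- The vertices that have the color `l + 1` or `-(l + 1)`, with the sign of this color. -/
def topSigns (l : ℕ) (κ : V → ℤ) (v : V) : ℤ :=
  if κ v = l + 1 then 1 else if κ v = -(l + 1) then -1 else 0

theorem topSigns_mem [DecidableEq V] {P : S.Orientation} {W : Finset V} {l : ℕ} {κ : V → ℤ}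
    (hκ : κ ∈ P.boundedColorings W (l + 1)) :
    topSigns l κ ∈ Fintype.piFinset (P.extremalSigns W) := by
  obtain ⟨h1, h2, h3⟩ := mem_boundedColorings.1 hκ
  refine Fintype.mem_piFinset.2 fun v => mem_extremalSigns.2 ?_
  have key : ∀ d : ℤ, (d = 1 ∨ d = -1) → κ v = d * (l + 1) →
      v ∈ W ∧ P.IsExtremal W v d := by
    intro d hd hv
    refine ⟨?_, fun e s he hs => ?_⟩
    · by_contra hvW
      rw [h2 v hvW] at hv
      rcases hd with rfl | rfl <;> omega
    · have h4 := h3 e he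
      rw [P.form_eq _ _ s, hs, hv] at h4
      have h5 := h1 _ (he (!s))
      push_cast at h5
      rcases hd with rfl | rfl <;> rcases P.arrow_eq_or e s with h | h <;>
        rcases P.arrow_eq_or e (!s) with h' | h' <;> rw [h, h'] at h4 <;> omega
  unfold topSigns
  split_ifs with ha hb
  · exact Or.inr ⟨Or.inl rfl, key 1 (Or.inl rfl) (by rw [ha]; ring)⟩
  · exact Or.inr ⟨Or.inr rfl, key (-1) (Or.inr rfl) (by rw [hb]; ring)⟩
  · exact Or.inl rfl

/-- A coloring with largest absolute value at most `l + 1` amounts to the admissible choice of the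
vertices of colors `l + 1` and `-(l + 1)` and a coloring of the remaining vertices. -/
theorem card_boundedColorings_fiber [DecidableEq V] (P : S.Orientation) (W : Finset V) (l : ℕ)
    {σ : V → ℤ} (hσ : σ ∈ Fintype.piFinset (P.extremalSigns W)) :
    ((P.boundedColorings W (l + 1)).filter fun κ => topSigns l κ = σ).card =
      (P.boundedColorings (W.filter fun v => σ v = 0) l).card := by
  have hσ' : ∀ v, σ v ≠ 0 → (σ v = 1 ∨ σ v = -1) ∧ v ∈ W ∧ P.IsExtremal W v (σ v) := fun v hv =>
    (mem_extremalSigns.1 (Fintype.mem_piFinset.1 hσ v)).resolve_left hv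
  refine Finset.card_bij' (fun κ _ v => if σ v = 0 then κ v else 0)
    (fun κ _ v => κ v + (l + 1) * σ v) ?_ ?_ ?_ ?_
  · intro κ hκ
    rw [Finset.mem_filter, mem_boundedColorings] at hκ
    obtain ⟨⟨h1, h2, h3⟩, rfl⟩ := hκ
    refine mem_boundedColorings.2 ⟨fun v hv => ?_, fun v hv => ?_, fun e he => ?_⟩
    · obtain ⟨hv, hv'⟩ := Finset.mem_filter.1 hv
      have := h1 v hv
      simp only [hv', if_true]
      unfold topSigns at hv'
      push_cast at this
      split_ifs at hv' <;> omega
    · rw [Finset.mem_filter, not_and] at hv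
      split_ifs with h
      · exact h2 v fun hv' => hv hv' h
      · rfl
    · have he' : ∀ s, S.ends e s ∈ W ∧ topSigns l κ (S.ends e s) = 0 := fun s =>
        Finset.mem_filter.1 (he s)
      have := h3 e fun s => (he' s).1
      simpa only [form, (he' _).2, if_true] using this
  · intro κ hκ
    obtain ⟨h1, h2, h3⟩ := mem_boundedColorings.1 hκ
    simp only [Finset.mem_filter, not_and] at h1 h2
    have hzero : ∀ v, σ v ≠ 0 → κ v = 0 := fun v hv => h2 v fun _ => hv
    have hb : ∀ v, -(l : ℤ) ≤ κ v ∧ κ v ≤ l := by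
      intro v
      by_cases hv : v ∈ W ∧ σ v = 0
      · exact h1 v hv
      · rw [h2 v fun h h' => hv ⟨h, h'⟩]
        omega
    refine Finset.mem_filter.2 ⟨mem_boundedColorings.2 ⟨fun v hv => ?_, fun v hv => ?_,
      fun e he => ?_⟩, ?_⟩
    · have := hb v
      push_cast
      by_cases h : σ v = 0
      · rw [h]; omega
      · rw [hzero v h]
        rcases (hσ' v h).1 with h | h <;> rw [h] <;> omega
    · have h : σ v = 0 := by
        by_contra h
        exact hv (hσ' v h).2.1
      simp [h, h2 v fun hv' => absurd hv' hv]
    · have key : ∀ s, -(l : ℤ) ≤ P.arrow e s * (κ (S.ends e s) + (l + 1) * σ (S.ends e s)) ∧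
          (σ (S.ends e s) ≠ 0 →
            P.arrow e s * (κ (S.ends e s) + (l + 1) * σ (S.ends e s)) = l + 1) := by
        intro s
        by_cases h : σ (S.ends e s) = 0
        · refine ⟨?_, fun h' => absurd h h'⟩
          have := hb (S.ends e s)
          rcases P.arrow_eq_or e s with h' | h' <;> rw [h, h'] <;> omega
        · obtain ⟨ha, -, hb⟩ := hσ' _ h
          have : P.arrow e s * (κ (S.ends e s) + (l + 1) * σ (S.ends e s)) = l + 1 := by
            rw [hzero _ h, hb e s he rfl]
            rcases ha with ha | ha <;> rw [ha] <;> ring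
          exact ⟨by omega, fun _ => this⟩
      by_cases hall : ∀ s, σ (S.ends e s) = 0
      · have := h3 e fun s => Finset.mem_filter.2 ⟨he s, hall s⟩
        simpa [form, hall] using this
      · push Not at hall
        obtain ⟨s, hs⟩ := hall
        rw [P.form_eq _ _ s]
        have h4 := (key s).2 hs
        have h5 := (key (!s)).1
        omega
    · funext v
      have := hb v
      unfold topSigns
      beta_reduce
      by_cases h : σ v = 0
      · rw [h, if_neg (by omega), if_neg (by omega)]
      · rw [hzero v h]
        rcases (hσ' v h).1 with h | h <;> rw [h]
        · rw [if_pos (by ring)]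
        · rw [if_neg (by omega), if_pos (by ring)]
  · intro κ hκ
    obtain ⟨-, rfl⟩ := Finset.mem_filter.1 hκ
    funext v
    dsimp only
    unfold topSigns
    split_ifs <;> simp_all
  · intro κ hκ
    obtain ⟨h1, h2, h3⟩ := mem_boundedColorings.1 hκ
    funext v
    dsimp only
    split_ifs with h
    · rw [h]; ring
    · exact (h2 v fun hv => h (Finset.mem_filter.1 hv).2).symm

theorem card_boundedColorings_succ [DecidableEq V] (P : S.Orientation) (W : Finset V) (l : ℕ) :
    (P.boundedColorings W (l + 1)).card = ∑ σ ∈ Fintype.piFinset (P.extremalSigns W),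
      (P.boundedColorings (W.filter fun v => σ v = 0) l).card := by
  rw [Finset.card_eq_sum_card_fiberwise (f := topSigns l)
    (t := Fintype.piFinset (P.extremalSigns W)) fun κ hκ => topSigns_mem hκ]
  exact Finset.sum_congr rfl fun σ hσ => P.card_boundedColorings_fiber W l hσ

theorem zero_mem_piFinset_extremalSigns [DecidableEq V] (P : S.Orientation) (W : Finset V) :
    (0 : V → ℤ) ∈ Fintype.piFinset (P.extremalSigns W) :=
  Fintype.mem_piFinset.2 fun _ => mem_extremalSigns.2 (Or.inl rfl)

theorem filter_ssubset_of_mem [DecidableEq V] {P : S.Orientation} {W : Finset V} {σ : V → ℤ}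
    (hσ : σ ∈ (Fintype.piFinset (P.extremalSigns W)).erase 0) :
    W.filter (fun v => σ v = 0) ⊂ W := by
  obtain ⟨h0, hσ⟩ := Finset.mem_erase.1 hσ
  obtain ⟨v, hv⟩ := Function.ne_iff.1 h0
  have := (mem_extremalSigns.1 (Fintype.mem_piFinset.1 hσ v)).resolve_left hv
  exact Finset.filter_ssubset.2 ⟨v, this.2.1, hv⟩

/-- The number of bounded colorings is a polynomial in the bound. -/
theorem exists_polynomial_boundedColorings (P : S.Orientation) (W : Finset V) :
    ∃ p : ℚ[X], ∀ l : ℕ, p.eval (l : ℚ) = ((P.boundedColorings W l).card : ℚ) := by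
  classical
  induction W using Finset.strongInduction with
  | H W ih =>
    choose! p hp using ih
    refine exists_polynomial_of_forall_succ_sub
      (r := ∑ σ ∈ (Fintype.piFinset (P.extremalSigns W)).erase 0,
        p (W.filter fun v => σ v = 0)) fun l => ?_
    rw [card_boundedColorings_succ, ← Finset.add_sum_erase _ _ (zero_mem_piFinset_extremalSigns P W)]
    simp only [Pi.zero_apply, Finset.filter_true, Nat.cast_add, Nat.cast_sum, eval_finsetSum]
    rw [add_sub_cancel_left]
    exact Finset.sum_congr rfl fun σ hσ => (hp _ (filter_ssubset_of_mem hσ) l).symm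

/-- The polynomial in `l` that counts the compatible colorings on `W` in the colors `-l, …, l`. -/
noncomputable def orderPolynomial (P : S.Orientation) (W : Finset V) : ℚ[X] :=
  (P.exists_polynomial_boundedColorings W).choose

theorem eval_orderPolynomial (P : S.Orientation) (W : Finset V) (l : ℕ) :
    (P.orderPolynomial W).eval (l : ℚ) = ((P.boundedColorings W l).card : ℚ) :=
  (P.exists_polynomial_boundedColorings W).choose_spec l

theorem orderPolynomial_zero_eq_sum [DecidableEq V] (P : S.Orientation) (W : Finset V) :
    (P.orderPolynomial W).eval 0 = ∑ σ ∈ Fintype.piFinset (P.extremalSigns W),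
      (P.orderPolynomial (W.filter fun v => σ v = 0)).eval (-1) := by
  have h : (P.orderPolynomial W).comp (X + 1) = ∑ σ ∈ Fintype.piFinset (P.extremalSigns W),
      P.orderPolynomial (W.filter fun v => σ v = 0) := by
    refine eq_of_forall_eval_natCast fun l => ?_
    rw [eval_comp, eval_finsetSum]
    simp only [eval_add, eval_X, eval_one, eval_orderPolynomial]
    rw [← Nat.cast_add_one, eval_orderPolynomial, card_boundedColorings_succ, Nat.cast_sum]
  have := congrArg (eval (-1)) h
  rw [eval_comp, eval_finsetSum] at this
  simpa using this

theorem orderPolynomial_neg_one_of_no_edge (P : S.Orientation) {W : Finset V}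
    (hW : ∀ e, ¬ S.EdgeIn W e) : (P.orderPolynomial W).eval (-1) = (-1) ^ W.card := by
  classical
  have h : P.orderPolynomial W = (2 * X + 1) ^ W.card := by
    refine eq_of_forall_eval_natCast fun l => ?_
    rw [eval_orderPolynomial, boundedColorings, Finset.filter_true_of_mem fun κ _ e he =>
      absurd he (hW e), Fintype.card_piFinset]
    have : ∀ v, (if v ∈ W then Finset.Icc (-(l : ℤ)) l else {0}).card =
        if v ∈ W then 2 * l + 1 else 1 := by
      intro v
      split_ifs
      · simp; omega
      · simp
    simp only [this, Finset.prod_ite_mem, Finset.univ_inter, Finset.prod_const]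
    simp
  rw [h]
  norm_num

theorem neg_one_pow_card_filter (W : Finset V) (P : S.Orientation) [DecidableEq V] {σ : V → ℤ}
    (hσ : σ ∈ Fintype.piFinset (P.extremalSigns W)) :
    (-1 : ℚ) ^ (W.filter fun v => σ v = 0).card =
      (-1) ^ W.card * ∏ v, (-1 : ℚ) ^ (σ v).natAbs := by
  have h1 : (W.filter fun v => ¬ σ v = 0) = Finset.univ.filter fun v => σ v ≠ 0 := by
    ext v
    simp only [Finset.mem_filter, Finset.mem_univ, true_and]
    refine ⟨fun h => h.2, fun h => ⟨?_, h⟩⟩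
    exact ((mem_extremalSigns.1 (Fintype.mem_piFinset.1 hσ v)).resolve_left h).2.1
  have h2 : ∏ v, (-1 : ℚ) ^ (σ v).natAbs = (-1) ^ (W.filter fun v => ¬ σ v = 0).card := by
    rw [h1, ← Finset.prod_const, Finset.prod_filter]
    refine Finset.prod_congr rfl fun v _ => ?_
    split_ifs with h
    · rcases ((mem_extremalSigns.1 (Fintype.mem_piFinset.1 hσ v)).resolve_left h).1 with h | h <;>
        simp [h]
    · push Not at h
      simp [h]
  rw [h2, ← Finset.card_filter_add_card_filter_not (s := W) (fun v => σ v = 0), pow_add, mul_assoc,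
    ← pow_add, ← two_mul, pow_mul]
  simp

/-- The signed sum over the choices of extreme vertices vanishes: at a non-isolated extremal vertex
exactly one of the signs `1`, `-1` is admissible, and it cancels against `0`. -/
theorem sum_neg_one_pow_card_filter_eq_zero [DecidableEq V] {P : S.Orientation} (hP : P.Peelable)
    {W : Finset V} (hW : ∃ e, S.EdgeIn W e) :
    ∑ σ ∈ Fintype.piFinset (P.extremalSigns W),
      (-1 : ℚ) ^ (W.filter fun v => σ v = 0).card = 0 := by
  rw [Finset.sum_congr rfl fun σ hσ => neg_one_pow_card_filter W P hσ, ← Finset.mul_sum,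
    ← Finset.prod_univ_sum (P.extremalSigns W) fun _ (d : ℤ) => (-1 : ℚ) ^ d.natAbs]
  obtain ⟨e, s, d, he, hd, hext⟩ := hP W hW
  refine mul_eq_zero_of_right _ (Finset.prod_eq_zero (Finset.mem_univ (S.ends e s)) ?_)
  have : P.extremalSigns W (S.ends e s) = {0, d} := by
    ext d'
    rw [mem_extremalSigns, Finset.mem_insert, Finset.mem_singleton]
    refine or_congr_right ⟨fun h => ?_, fun h => h ▸ ⟨hd, he s, hext⟩⟩
    rw [← h.2.2 e s he rfl, hext e s he rfl]
  rw [this, Finset.sum_pair (by rcases hd with rfl | rfl <;> norm_num)]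
  rcases hd with rfl | rfl <;> norm_num

/-- Reciprocity: the open cone of compatible colorings has Euler characteristic `(-1)^n`. -/
theorem orderPolynomial_neg_one {P : S.Orientation} (hP : P.Peelable) (W : Finset V) :
    (P.orderPolynomial W).eval (-1) = (-1) ^ W.card := by
  classical
  induction W using Finset.strongInduction with
  | H W ih =>
    by_cases hW : ∃ e, S.EdgeIn W e
    · have h0 : (P.orderPolynomial W).eval 0 = 0 := by
        have := P.eval_orderPolynomial W 0
        rw [Nat.cast_zero] at this
        rw [this, Nat.cast_eq_zero, Finset.card_eq_zero, Finset.eq_empty_iff_forall_notMem]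
        intro κ hκ
        obtain ⟨h1, h2, h3⟩ := mem_boundedColorings.1 hκ
        obtain ⟨e, he⟩ := hW
        have h4 := h3 e he
        have hz : ∀ s, κ (S.ends e s) = 0 := fun s => by
          have := h1 _ (he s)
          push_cast at this
          omega
        simp [form, hz] at h4
      have h1 := sum_neg_one_pow_card_filter_eq_zero hP hW
      rw [orderPolynomial_zero_eq_sum,
        ← Finset.add_sum_erase _ _ (zero_mem_piFinset_extremalSigns P W)] at h0
      rw [← Finset.add_sum_erase _ _ (zero_mem_piFinset_extremalSigns P W)] at h1
      rw [Finset.sum_congr rfl fun σ hσ => ih _ (filter_ssubset_of_mem hσ)] at h0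
      simp only [Pi.zero_apply, Finset.filter_true] at h0 h1
      linarith
    · exact P.orderPolynomial_neg_one_of_no_edge (not_exists.1 hW)

end SignedGraph.Orientation

/-! ### The span of the signed posets -/

namespace SignedGraph

variable {V E : Type*} {S : SignedGraph V E}

instance finite_orientation [Finite E] : Finite S.Orientation :=
  Finite.of_injective Orientation.toward fun _ _ h => Orientation.ext h

theorem Orientation.Y_eq [Fintype V] (P : S.Orientation) :
    P.Y = formalSum (fun κ : {κ : V → ℤ // P.Compatible κ} => colorMonomial κ.1) :=
  formalSum_equiv (Equiv.subtypeEquivRight P.isProper_and_isPreservedBy_iff) fun _ => rfl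

/-- Every proper coloring preserves exactly one orientation, and this orientation is acyclic. -/
theorem chromaticB_eq_sum [Fintype V] [Fintype {P : S.Orientation // P.Acyclic}] :
    S.chromaticB = ∑ P : {P : S.Orientation // P.Acyclic}, P.1.Y := by
  have hac : ∀ κ : {κ : V → ℤ // S.IsProper κ}, (Orientation.ofColoring κ.1 κ.2).Acyclic := fun κ =>
    (((Orientation.isProper_and_isPreservedBy_iff _ κ.1).1
      ⟨κ.2, (Orientation.isPreservedBy_iff_eq_ofColoring _ κ.2).2 rfl⟩)).acyclic
  rw [chromaticB, formalSum_eq_sum_fiber (finiteFibers_colorMonomial.subtype _)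
    fun κ => (⟨Orientation.ofColoring κ.1 κ.2, hac κ⟩ : {P : S.Orientation // P.Acyclic})]
  refine Finset.sum_congr rfl fun P _ => ?_
  refine formalSum_equiv (((Equiv.subtypeSubtypeEquivSubtypeExists _ _)).trans
    (Equiv.subtypeEquivRight fun κ => ?_)) fun κ => rfl
  constructor
  · rintro ⟨h, h'⟩
    exact ⟨h, (Orientation.isPreservedBy_iff_eq_ofColoring _ h).2 (congrArg Subtype.val h')⟩
  · rintro ⟨h, h'⟩
    exact ⟨h, Subtype.ext ((Orientation.isPreservedBy_iff_eq_ofColoring _ h).1 h')⟩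

/-- A copy of a signed graph on other sets of vertices and edges. -/
def relabel {V' E' : Type*} (S : SignedGraph V E) (eV : V ≃ V') (eE : E' ≃ E) :
    SignedGraph V' E' where
  ends e s := eV (S.ends (eE e) s)
  sgn e := S.sgn (eE e)

/-- The disjoint union of two signed graphs. -/
def disjointUnion {V' E' : Type*} (S : SignedGraph V E) (S' : SignedGraph V' E') :
    SignedGraph (V ⊕ V') (E ⊕ E') where
  ends := Sum.elim (fun e s => Sum.inl (S.ends e s)) (fun e s => Sum.inr (S'.ends e s))
  sgn := Sum.elim S.sgn S'.sgn

namespace Orientation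

/-- The same arrows on a copy of the signed graph. -/
def relabel {V' E' : Type*} (P : S.Orientation) (eV : V ≃ V') (eE : E' ≃ E) :
    (S.relabel eV eE).Orientation where
  toward e := P.toward (eE e)
  positive e := P.positive (eE e)
  negative e := P.negative (eE e)

theorem compatible_relabel {V' E' : Type*} (P : S.Orientation) (eV : V ≃ V') (eE : E' ≃ E)
    (κ : V' → ℤ) : (P.relabel eV eE).Compatible κ ↔ P.Compatible (κ ∘ eV) :=
  ⟨fun h e => by simpa [form, arrow, relabel, SignedGraph.relabel] using h (eE.symm e),
    fun h e => h (eE e)⟩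

theorem Y_relabel [Fintype V] {V' E' : Type*} [Fintype V'] (P : S.Orientation) (eV : V ≃ V')
    (eE : E' ≃ E) : (P.relabel eV eE).Y = P.Y := by
  rw [Y_eq, Y_eq]
  exact formalSum_equiv ((eV.arrowCongr (Equiv.refl ℤ)).symm.subtypeEquiv
    (P.compatible_relabel eV eE)) fun κ => colorMonomial_comp_equiv eV κ.1

theorem acyclic_relabel [Fintype V] [Finite E] {V' E' : Type*} [Fintype V'] [Finite E']
    {P : S.Orientation} (hP : P.Acyclic) (eV : V ≃ V') (eE : E' ≃ E) :
    (P.relabel eV eE).Acyclic := by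
  obtain ⟨κ, hκ⟩ := acyclic_iff_exists_compatible.1 hP
  exact acyclic_iff_exists_compatible.2 ⟨κ ∘ eV.symm, (P.compatible_relabel _ _ _).2 (by
    simpa [Function.comp_def] using hκ)⟩

/-- The disjoint union of two orientations. -/
def disjointUnion {V' E' : Type*} {S' : SignedGraph V' E'} (P : S.Orientation)
    (P' : S'.Orientation) : (S.disjointUnion S').Orientation where
  toward := Sum.elim P.toward P'.toward
  positive e := by
    cases e
    · exact P.positive _
    · exact P'.positive _
  negative e := by
    cases e
    · exact P.negative _
    · exact P'.negative _

theorem compatible_disjointUnion {V' E' : Type*} {S' : SignedGraph V' E'} (P : S.Orientation)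
    (P' : S'.Orientation) (κ : V ⊕ V' → ℤ) :
    (P.disjointUnion P').Compatible κ ↔
      P.Compatible (κ ∘ Sum.inl) ∧ P'.Compatible (κ ∘ Sum.inr) :=
  Sum.forall

theorem acyclic_disjointUnion [Fintype V] [Finite E] {V' E' : Type*} [Fintype V'] [Finite E']
    {S' : SignedGraph V' E'} {P : S.Orientation} {P' : S'.Orientation} (hP : P.Acyclic)
    (hP' : P'.Acyclic) : (P.disjointUnion P').Acyclic := by
  obtain ⟨κ, hκ⟩ := acyclic_iff_exists_compatible.1 hP
  obtain ⟨κ', hκ'⟩ := acyclic_iff_exists_compatible.1 hP'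
  exact acyclic_iff_exists_compatible.2
    ⟨Sum.elim κ κ', (compatible_disjointUnion _ _ _).2 ⟨hκ, hκ'⟩⟩

theorem _root_.colorMonomial_sum [Fintype V] {V' : Type*} [Fintype V'] (κ : V ⊕ V' → ℤ) :
    colorMonomial κ = colorMonomial (κ ∘ Sum.inl) + colorMonomial (κ ∘ Sum.inr) :=
  Fintype.sum_sum_type _

theorem Y_mul_Y [Fintype V] {V' E' : Type*} [Fintype V'] {S' : SignedGraph V' E'}
    (P : S.Orientation) (P' : S'.Orientation) : P.Y * P'.Y = (P.disjointUnion P').Y := by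
  rw [Y_eq, Y_eq, Y_eq, formalSum_mul (finiteFibers_colorMonomial.subtype _)
    (finiteFibers_colorMonomial.subtype _)]
  symm
  refine formalSum_equiv (((Equiv.sumArrowEquivProdArrow V V' ℤ).subtypeEquiv
    (q := fun κ => P.Compatible κ.1 ∧ P'.Compatible κ.2)
    (P.compatible_disjointUnion P')).trans Equiv.subtypeProdEquivProd) fun κ => ?_
  exact (colorMonomial_sum κ.1).symm

theorem Y_mem_signedPosetSpan [Fintype V] [Finite E] {P : S.Orientation} (hP : P.Acyclic) :
    P.Y ∈ signedPosetSpan := by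
  have := Fintype.ofFinite E
  refine Submodule.subset_span ⟨_, _, _,
    P.relabel (Fintype.equivFin V) (Fintype.equivFin E).symm, acyclic_relabel hP _ _, ?_⟩
  rw [Y_relabel]

end Orientation

theorem chromaticB_mem_signedPosetSpan [Fintype V] [Finite E] (S : SignedGraph V E) :
    S.chromaticB ∈ signedPosetSpan := by
  have := Fintype.ofFinite {P : S.Orientation // P.Acyclic}
  rw [chromaticB_eq_sum]
  exact Submodule.sum_mem _ fun P _ => P.1.Y_mem_signedPosetSpan P.2

end SignedGraph

open SignedGraph

theorem mul_mem_signedPosetSpan {F G : MvPowerSeries ℤ ℚ} (hF : F ∈ signedPosetSpan)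
    (hG : G ∈ signedPosetSpan) : F * G ∈ signedPosetSpan := by
  have h := Submodule.mul_mem_mul hF hG
  rw [signedPosetSpan, Submodule.span_mul_span] at h
  refine Submodule.span_le.2 ?_ h
  rintro _ ⟨_, ⟨n, m, S, P, hP, rfl⟩, _, ⟨n', m', S', P', hP', rfl⟩, rfl⟩
  beta_reduce
  rw [Orientation.Y_mul_Y]
  exact Orientation.Y_mem_signedPosetSpan (Orientation.acyclic_disjointUnion hP hP')

/-- The coloring `κ` is improper at an edge of sign `c.2.2` with endpoints `c.1` and `c.2.1`. -/
def IsImproperAt {V : Type*} (κ : V → ℤ) (c : V × V × ℤˣ) : Prop := κ c.1 = (c.2.2 : ℤ) * κ c.2.1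

/-- The signed graph with a given list of edges. -/
def signedGraphOfList {V : Type*} (L : List (V × V × ℤˣ)) : SignedGraph V (Fin L.length) where
  ends e s := if s then (L.get e).1 else (L.get e).2.1
  sgn e := (L.get e).2.2

theorem isProper_signedGraphOfList {V : Type*} {L : List (V × V × ℤˣ)} {κ : V → ℤ} :
    (signedGraphOfList L).IsProper κ ↔ ∀ c ∈ L, ¬ IsImproperAt κ c := by
  simp only [IsProper, signedGraphOfList, List.forall_mem_iff_get, IsImproperAt]
  simp

/-- Colorings that are prescribed to be improper at some edges also have their generating function
in the span, by inclusion and exclusion over these edges. -/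
theorem formalSum_isImproperAt_mem {V : Type*} [Fintype V] (M L : List (V × V × ℤˣ)) :
    formalSum (fun κ : {κ : V → ℤ // (∀ c ∈ L, ¬ IsImproperAt κ c) ∧ ∀ c ∈ M, IsImproperAt κ c} =>
      colorMonomial κ.1) ∈ signedPosetSpan := by
  induction M generalizing L with
  | nil =>
    have := chromaticB_mem_signedPosetSpan (signedGraphOfList L)
    rw [chromaticB] at this
    convert this using 1
    exact formalSum_equiv (Equiv.subtypeEquivRight fun κ => by
      simp [isProper_signedGraphOfList]) fun κ => rfl
  | cons c M ih =>
    have h := formalSum_eq_add (finiteFibers_colorMonomial.subtype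
      fun κ : V → ℤ => (∀ c ∈ L, ¬ IsImproperAt κ c) ∧ ∀ c ∈ M, IsImproperAt κ c)
      fun κ => IsImproperAt κ.1 c
    have h1 := ih L
    have h2 := ih (c :: L)
    rw [h] at h1
    have h3 := Submodule.sub_mem _ h1 h2
    convert h3 using 1
    rw [eq_sub_iff_add_eq]
    congr 1
    · refine formalSum_equiv (Equiv.trans (Equiv.subtypeEquivRight fun κ => ?_)
        (Equiv.subtypeSubtypeEquivSubtypeInter (fun κ => (∀ c ∈ L, ¬ IsImproperAt κ c) ∧
          ∀ c ∈ M, IsImproperAt κ c) fun κ => IsImproperAt κ c).symm) fun κ => rfl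
      simp only [List.mem_cons, forall_eq_or_imp]
      tauto
    · refine formalSum_equiv (Equiv.trans (Equiv.subtypeEquivRight fun κ => ?_)
        (Equiv.subtypeSubtypeEquivSubtypeInter (fun κ => (∀ c ∈ L, ¬ IsImproperAt κ c) ∧
          ∀ c ∈ M, IsImproperAt κ c) fun κ => ¬ IsImproperAt κ c).symm) fun κ => rfl
      simp only [List.mem_cons, forall_eq_or_imp]
      tauto

theorem powerSum_comm (a b : ℕ) : powerSum a b = powerSum b a :=
  formalSum_equiv (Equiv.neg ℤ) fun i => by simp [add_comm]

theorem powerSum_mem_signedPosetSpan {a b : ℕ} (h : (a, b) ≠ (0, 0)) :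
    powerSum a b ∈ signedPosetSpan := by
  wlog ha : a ≠ 0 generalizing a b
  · rw [powerSum_comm]
    refine this (by simpa [and_comm] using h) fun hb => h ?_
    simp_all
  obtain ⟨a, rfl⟩ := Nat.exists_eq_succ_of_ne_zero ha
  -- `a + 1` vertices colored like the first one and `b` vertices of the opposite color
  let ε : Fin (a + 1) ⊕ Fin b → ℤˣ := Sum.elim (fun _ => 1) (fun _ => -1)
  convert formalSum_isImproperAt_mem
    (Finset.univ.toList.map fun v => (v, (Sum.inl 0 : Fin (a + 1) ⊕ Fin b), ε v)) [] using 1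
  refine formalSum_equiv ⟨fun i => ⟨fun v => ε v * i, ?_⟩, fun κ => κ.1 (Sum.inl 0), ?_, ?_⟩ ?_
  · simp [IsImproperAt, ε]
  · intro i
    simp [ε]
  · rintro ⟨κ, -, hκ⟩
    ext v
    exact (hκ _ (List.mem_map.2 ⟨v, Finset.mem_toList.2 (Finset.mem_univ v), rfl⟩)).symm
  · intro i
    simp [colorMonomial, ε, Fintype.sum_sum_type]

theorem X_zero_eq_formalSum :
    (MvPowerSeries.X 0 : MvPowerSeries ℤ ℚ) = formalSum fun _ : Unit => Finsupp.single 0 1 := by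
  rw [formalSum_unique]
  rfl

theorem X_zero_mem_signedPosetSpan : (MvPowerSeries.X 0 : MvPowerSeries ℤ ℚ) ∈ signedPosetSpan := by
  convert formalSum_isImproperAt_mem [((), (), -1)] [] using 1
  rw [X_zero_eq_formalSum]
  refine formalSum_equiv ⟨fun _ => ⟨0, ?_⟩, fun _ => (), fun _ => rfl, ?_⟩ ?_
  · simp [IsImproperAt]
  · rintro ⟨κ, hκ⟩
    ext v
    have : κ () = -κ () := by simpa [IsImproperAt] using hκ
    simp only [Pi.zero_apply]
    change 0 = κ ()
    omega
  · intro _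
    simp [colorMonomial]

theorem one_mem_signedPosetSpan : (1 : MvPowerSeries ℤ ℚ) ∈ signedPosetSpan := by
  convert formalSum_isImproperAt_mem (V := Empty) [] [] using 1
  have : Unique {κ : Empty → ℤ // (∀ c ∈ ([] : List (Empty × Empty × ℤˣ)), ¬ IsImproperAt κ c) ∧
      ∀ c ∈ ([] : List (Empty × Empty × ℤˣ)), IsImproperAt κ c} :=
    ⟨⟨⟨fun v => v.elim, by simp⟩⟩, fun κ => Subtype.ext (Subsingleton.elim _ _)⟩
  rw [formalSum_unique]
  simp [colorMonomial]

/-! ### The chromatic specialization and the sink counting function -/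

/-- A function on a spanning family extends to a linear map if it respects all linear relations. -/
theorem exists_linearMap_of_forall_linearCombination_eq_zero {ι M N : Type*} [AddCommGroup M]
    [Module ℚ M] [AddCommGroup N] [Module ℚ N] {W : Submodule ℚ M} {y : ι → M} (h : ι → N)
    (hW : W = Submodule.span ℚ (Set.range y))
    (hrel : ∀ c, Finsupp.linearCombination ℚ y c = 0 → Finsupp.linearCombination ℚ h c = 0) :
    ∃ f : W →ₗ[ℚ] N, ∀ i, ∃ hi : y i ∈ W, f ⟨y i, hi⟩ = h i := by
  subst hW
  have hmem : ∀ c, Finsupp.linearCombination ℚ y c ∈ Submodule.span ℚ (Set.range y) := fun c => by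
    rw [Finsupp.mem_span_range_iff_exists_finsupp]
    exact ⟨c, by rw [Finsupp.linearCombination_apply]⟩
  let π := (Finsupp.linearCombination ℚ y).codRestrict _ hmem
  have hπ : LinearMap.range π = ⊤ := by
    rw [LinearMap.range_eq_top]
    rintro ⟨x, hx⟩
    obtain ⟨c, hc⟩ := (Finsupp.mem_span_range_iff_exists_finsupp).1 hx
    exact ⟨c, Subtype.ext (by simpa [π, Finsupp.linearCombination_apply] using hc)⟩
  obtain ⟨s, hs⟩ := π.exists_rightInverse_of_surjective hπ
  refine ⟨Finsupp.linearCombination ℚ h ∘ₗ s, fun i => ⟨Submodule.subset_span ⟨i, rfl⟩, ?_⟩⟩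
  have h1 : π (s ⟨y i, Submodule.subset_span ⟨i, rfl⟩⟩) = π (Finsupp.single i 1) := by
    rw [← LinearMap.comp_apply, hs]
    exact Subtype.ext (by simp [π])
  have h2 := hrel (s ⟨y i, Submodule.subset_span ⟨i, rfl⟩⟩ - Finsupp.single i 1) (by
    rw [map_sub, sub_eq_zero]
    exact congrArg Subtype.val h1)
  rw [map_sub, sub_eq_zero] at h2
  simpa using h2

namespace SignedGraph

/-- The sum of the coefficients of the monomials in `x_{-l}, …, x_l` with exponents at most `N`, that is,
for large `N`, the value of a series of bounded degree at `x_{-l} = ⋯ = x_l = 1` and all other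
variables `0`. On a generating function it counts the colorings in the colors `-l, …, l`. -/
noncomputable def countFunctional (l N : ℕ) : MvPowerSeries ℤ ℚ →ₗ[ℚ] ℚ :=
  weightedCoeffSum (monomialBox (Finset.Icc (-(l : ℤ)) l) N) fun _ => 1

/-- The sum, with the sign `(-1)^degree`, of the coefficients of the monomials in `x_{-l}, …, x_{l+1}`
with exponents at most `N` in which `x_{l+1}` has the exponent `j`. On a generating function it
counts, up to sign, the colorings in the colors `-l, …, l + 1` for which exactly `j` vertices have
the color `l + 1`. -/
noncomputable def topFunctional (j l N : ℕ) : MvPowerSeries ℤ ℚ →ₗ[ℚ] ℚ :=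
  weightedCoeffSum (monomialBox (Finset.Icc (-(l : ℤ)) (l + 1)) N)
    fun m => if m (l + 1) = j then (-1) ^ m.degree else 0

variable {V E : Type*} {S : SignedGraph V E} [Fintype V]

theorem countFunctional_formalSum {T : Type*} {l N : ℕ} (κ : T → V → ℤ)
    (hκ : Function.Injective κ) (hN : Fintype.card V ≤ N) :
    countFunctional l N (formalSum fun t => colorMonomial (κ t)) =
      (Nat.card {t // ∀ v, -(l : ℤ) ≤ κ t v ∧ κ t v ≤ l} : ℚ) := by
  classical
  have hfin : {t | ∀ v, -(l : ℤ) ≤ κ t v ∧ κ t v ≤ l}.Finite :=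
    Set.Finite.of_finite_image ((Set.finite_Icc (fun _ : V => -(l : ℤ)) (fun _ => (l : ℤ))).subset
      (by rintro _ ⟨t, ht, rfl⟩; exact ⟨fun v => (ht v).1, fun v => (ht v).2⟩)) hκ.injOn
  rw [countFunctional, weightedCoeffSum_formalSum _ _ _ hfin.toFinset fun t => by
    rw [colorMonomial_mem_monomialBox hN]; simp]
  rw [Finset.sum_const, nsmul_eq_mul, mul_one, ← Nat.card_eq_finsetCard]
  congr 1
  exact Nat.card_congr (Equiv.subtypeEquivRight fun t => by simp)

theorem countFunctional_Y (P : S.Orientation) {l N : ℕ} (hN : Fintype.card V ≤ N) :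
    countFunctional l N P.Y = (P.orderPolynomial Finset.univ).eval (l : ℚ) := by
  rw [P.Y_eq, countFunctional_formalSum _ Subtype.val_injective hN, P.eval_orderPolynomial,
    ← Nat.card_eq_finsetCard]
  congr 1
  refine Nat.card_congr ((Equiv.subtypeSubtypeEquivSubtypeInter P.Compatible fun κ : V → ℤ =>
    ∀ v, -(l : ℤ) ≤ κ v ∧ κ v ≤ l).trans (Equiv.subtypeEquivRight fun κ => ?_))
  simp [Orientation.mem_boundedColorings, Orientation.Compatible, EdgeIn, and_comm]

namespace Orientation

open Classical in
/-- The sinks, as a finset. -/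
noncomputable def sinks (P : S.Orientation) : Finset V := Finset.univ.filter P.IsSink

theorem card_sinks (P : S.Orientation) : P.sinks.card = P.sinkCount := by
  classical
  rw [sinkCount, sinks, Nat.card_eq_fintype_card, Fintype.card_subtype]

theorem mem_sinks_iff {P : S.Orientation} {v : V} :
    v ∈ P.sinks ↔ P.IsExtremal Finset.univ v 1 := by
  simp only [sinks, Finset.mem_filter, Finset.mem_univ, true_and, IsSink, IsExtremal, EdgeIn,
    arrow]
  refine forall_congr' fun e => forall_congr' fun s => ?_
  cases P.toward e s <;> simp

open Classical in
/-- The polynomial in `l` that counts, up to the sign `(-1)^n`, the compatible colorings in the colors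
`-l, …, l + 1` for which exactly `j` vertices have the color `l + 1`. These vertices form an arbitrary
set of `j` sinks. -/
noncomputable def topPolynomial (P : S.Orientation) (j : ℕ) : ℚ[X] :=
  C ((-1) ^ Fintype.card V) * ∑ s ∈ P.sinks.powersetCard j, P.orderPolynomial sᶜ

theorem eval_topPolynomial_neg_one {P : S.Orientation} (hP : P.Peelable) (j : ℕ) :
    (P.topPolynomial j).eval (-1) = (-1) ^ j * (P.sinkCount.choose j : ℚ) := by
  classical
  rw [topPolynomial, eval_mul, eval_C, eval_finsetSum, Finset.sum_congr rfl
    (g := fun _ => (-1 : ℚ) ^ Fintype.card V * (-1) ^ j), Finset.sum_const,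
    Finset.card_powersetCard, card_sinks, nsmul_eq_mul]
  · have : ((-1 : ℚ) ^ Fintype.card V) * (-1) ^ Fintype.card V = 1 := by
      rw [← mul_pow]; simp
    linear_combination (((-1 : ℚ) ^ j) * (P.sinkCount.choose j)) * this
  · intro s hs
    rw [orderPolynomial_neg_one hP, ← (Finset.mem_powersetCard.1 hs).2, ← Finset.card_compl_add_card s,
      pow_add, mul_assoc, ← mul_pow]
    simp

theorem topFunctional_Y (P : S.Orientation) {j l N : ℕ} (hN : Fintype.card V ≤ N) :
    topFunctional j l N P.Y = (P.topPolynomial j).eval (l : ℚ) := by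
  classical
  let K : Finset (V → ℤ) := (P.boundedColorings Finset.univ (l + 1)).filter
    fun κ => ∀ v, κ v ≠ -(l + 1)
  have hK : ∀ κ, κ ∈ K ↔ P.Compatible κ ∧ ∀ v, κ v ∈ Finset.Icc (-(l : ℤ)) (l + 1) := by
    intro κ
    simp only [K, Finset.mem_filter, mem_boundedColorings, Finset.mem_univ, true_implies,
      not_true_eq_false, false_implies, implies_true, true_and, EdgeIn, Compatible,
      Finset.mem_Icc]
    constructor
    · rintro ⟨⟨h1, h2⟩, h3⟩
      refine ⟨h2, fun v => ?_⟩
      have := h1 v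
      have := h3 v
      push_cast at *
      omega
    · rintro ⟨h1, h2⟩
      refine ⟨⟨fun v => ?_, h1⟩, fun v => ?_⟩ <;>
      · have := h2 v
        push_cast
        omega
  let top (κ : V → ℤ) : Finset V := Finset.univ.filter fun v => κ v = l + 1
  have htop : ∀ κ, colorMonomial κ (l + 1) = (top κ).card := fun κ => colorMonomial_apply _ _
  have hsub : ∀ κ ∈ K, top κ ⊆ P.sinks := by
    intro κ hκ v hv
    have h1 := Fintype.mem_piFinset.1 (topSigns_mem (Finset.mem_filter.1 hκ).1) v
    have h2 : topSigns l κ v = 1 := if_pos (Finset.mem_filter.1 hv).2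
    rw [h2, mem_extremalSigns] at h1
    simpa [mem_sinks_iff] using h1
  have hfib : ∀ s ∈ P.sinks.powersetCard j, (K.filter fun κ => top κ = s).card =
      (P.boundedColorings sᶜ l).card := by
    intro s hs
    have hσ : (fun v => if v ∈ s then (1 : ℤ) else 0) ∈
        Fintype.piFinset (P.extremalSigns Finset.univ) := by
      refine Fintype.mem_piFinset.2 fun v => mem_extremalSigns.2 ?_
      split_ifs with hv
      · exact Or.inr ⟨Or.inl rfl, Finset.mem_univ _,
          mem_sinks_iff.1 ((Finset.mem_powersetCard.1 hs).1 hv)⟩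
      · exact Or.inl rfl
    have h := P.card_boundedColorings_fiber Finset.univ l hσ
    have hc : (Finset.univ.filter fun v => (if v ∈ s then (1 : ℤ) else 0) = 0) = sᶜ := by
      ext v
      simp
    rw [hc] at h
    rw [← h, Finset.filter_filter]
    congr 1
    ext κ
    simp only [Finset.mem_filter]
    refine and_congr_right fun _ => ?_
    rw [funext_iff, Finset.ext_iff]
    simp only [top, Finset.mem_filter, Finset.mem_univ, true_and, topSigns]
    rw [← forall_and]
    refine forall_congr' fun v => ?_
    split_ifs <;> grind
  rw [P.Y_eq, topFunctional, weightedCoeffSum_formalSum _ _ _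
    (K.subtype P.Compatible) fun κ => by
      rw [Finset.mem_subtype, colorMonomial_mem_monomialBox hN, hK]
      exact and_iff_right κ.2]
  rw [Finset.sum_subtype_of_mem (fun κ => if colorMonomial κ (l + 1) = j then
    (-1 : ℚ) ^ (colorMonomial κ).degree else 0) fun κ hκ => ((hK κ).1 hκ).1]
  simp only [degree_colorMonomial, htop]
  rw [← Finset.sum_filter, Finset.sum_const, nsmul_eq_mul, mul_comm, topPolynomial, eval_mul,
    eval_C, eval_finsetSum, Finset.card_eq_sum_card_fiberwise (f := top)
      (t := P.sinks.powersetCard j) fun κ hκ => Finset.mem_coe.2 (Finset.mem_powersetCard.2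
        ⟨hsub κ (Finset.mem_filter.1 (Finset.mem_coe.1 hκ)).1,
          (Finset.mem_filter.1 (Finset.mem_coe.1 hκ)).2⟩), Nat.cast_sum]
  congr 1
  refine Finset.sum_congr rfl fun s hs => ?_
  rw [eval_orderPolynomial, ← hfib s hs, Finset.filter_filter]
  congr 3
  ext κ
  exact and_iff_right_of_imp fun h => h ▸ (Finset.mem_powersetCard.1 hs).2

end Orientation

/-- Signed posets on the vertex sets `Fin n`. -/
abbrev SignedPoset : Type :=
  Σ (n m : ℕ) (S : SignedGraph (Fin n) (Fin m)), {P : S.Orientation // P.Acyclic}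

theorem signedPosetSpan_eq_span_range :
    signedPosetSpan = Submodule.span ℚ (Set.range fun p : SignedPoset => p.2.2.2.1.Y) := by
  rw [signedPosetSpan]
  congr 1
  ext F
  constructor
  · rintro ⟨n, m, S, P, hP, rfl⟩
    exact ⟨⟨n, m, S, P, hP⟩, rfl⟩
  · rintro ⟨⟨n, m, S, P, hP⟩, rfl⟩
    exact ⟨n, m, S, P, hP, rfl⟩

/-- Polynomials whose values at natural numbers are given by linear functionals of the `Y_P` satisfy
all linear relations among the `Y_P`. -/
theorem linearCombination_polynomial_eq_zero {Λ : ℕ → ℕ → MvPowerSeries ℤ ℚ →ₗ[ℚ] ℚ}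
    {q : SignedPoset → ℚ[X]}
    (hq : ∀ (p : SignedPoset) (l N : ℕ), p.1 ≤ N → Λ l N p.2.2.2.1.Y = (q p).eval (l : ℚ))
    {c : SignedPoset →₀ ℚ}
    (hc : Finsupp.linearCombination ℚ (fun p : SignedPoset => p.2.2.2.1.Y) c = 0) :
    Finsupp.linearCombination ℚ q c = 0 := by
  refine eq_of_forall_eval_natCast fun l => ?_
  have h := congrArg (Λ l (c.support.sup Sigma.fst)) hc
  rw [Finsupp.linearCombination_apply, Finsupp.sum] at h ⊢
  simp only [map_sum, map_smul, map_zero, smul_eq_mul] at h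
  rw [eval_finsetSum, eval_zero, ← h]
  refine Finset.sum_congr rfl fun p hp => ?_
  rw [eval_smul, smul_eq_mul, hq p l _ (Finset.le_sup (f := Sigma.fst) hp)]

/-- There is a linear map that computes the specialization of the variables `x_{-l}, …, x_l` to `1` and
of all other variables to `0`, as a polynomial in `l`. -/
theorem exists_eval_eq_countFunctional : ∃ f : signedPosetSpan →ₗ[ℚ] ℚ[X],
    ∀ (F : signedPosetSpan) (l : ℕ), ∃ N₀, ∀ N, N₀ ≤ N →
      countFunctional l N F = (f F).eval (l : ℚ) := by
  obtain ⟨f, hf⟩ := exists_linearMap_of_forall_linearCombination_eq_zero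
    (fun p : SignedPoset => p.2.2.2.1.orderPolynomial Finset.univ) signedPosetSpan_eq_span_range
    fun c hc => linearCombination_polynomial_eq_zero (Λ := countFunctional)
      (fun p l N hN => countFunctional_Y _ (by simpa using hN)) hc
  refine ⟨f, fun F l => ?_⟩
  obtain ⟨F, hF⟩ := F
  have hF' := hF
  rw [signedPosetSpan_eq_span_range] at hF'
  induction hF' using Submodule.span_induction with
  | mem F h =>
    obtain ⟨p, rfl⟩ := h
    obtain ⟨_, hp⟩ := hf p
    exact ⟨p.1, fun N hN => by rw [hp]; exact countFunctional_Y _ (by simpa using hN)⟩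
  | zero => exact ⟨0, fun N _ => by
      have : (⟨0, hF⟩ : signedPosetSpan) = 0 := rfl
      simp [this]⟩
  | add x y hx hy ihx ihy =>
    rw [← signedPosetSpan_eq_span_range] at hx hy
    obtain ⟨a, ha⟩ := ihx hx
    obtain ⟨b, hb⟩ := ihy hy
    refine ⟨max a b, fun N hN => ?_⟩
    have : (⟨x + y, hF⟩ : signedPosetSpan) = ⟨x, hx⟩ + ⟨y, hy⟩ := rfl
    rw [this, map_add, eval_add, ← ha N (le_of_max_le_left hN), ← hb N (le_of_max_le_right hN)]
    exact map_add _ _ _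
  | smul r x hx ih =>
    rw [← signedPosetSpan_eq_span_range] at hx
    obtain ⟨a, ha⟩ := ih hx
    refine ⟨a, fun N hN => ?_⟩
    have : (⟨r • x, hF⟩ : signedPosetSpan) = r • ⟨x, hx⟩ := rfl
    rw [this, map_smul, eval_smul, ← ha N hN]
    exact map_smul _ _ _

theorem orderPolynomial_disjointUnion {V' E' : Type*} [Fintype V'] {S' : SignedGraph V' E'}
    (P : S.Orientation) (P' : S'.Orientation) :
    (P.disjointUnion P').orderPolynomial Finset.univ =
      P.orderPolynomial Finset.univ * P'.orderPolynomial Finset.univ := by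
  refine eq_of_forall_eval_natCast fun l => ?_
  rw [eval_mul]
  simp only [Orientation.eval_orderPolynomial, ← Nat.card_eq_finsetCard, ← Nat.cast_mul,
    ← Nat.card_prod]
  congr 1
  refine Nat.card_congr (((Equiv.sumArrowEquivProdArrow V V' ℤ).subtypeEquiv
    (q := fun κ => κ.1 ∈ P.boundedColorings Finset.univ l ∧
      κ.2 ∈ P'.boundedColorings Finset.univ l) fun κ => ?_).trans Equiv.subtypeProdEquivProd)
  have := P.compatible_disjointUnion P' κ
  simp only [Orientation.Compatible] at this
  simp only [Orientation.mem_boundedColorings, Finset.mem_univ, true_implies, not_true_eq_false,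
    false_implies, implies_true, true_and, EdgeIn, this, Sum.forall]
  simp only [Equiv.sumArrowEquivProdArrow, Equiv.coe_fn_mk, Function.comp_def]
  tauto

theorem eval_eq_of_countFunctional {f : signedPosetSpan →ₗ[ℚ] ℚ[X]}
    (hf : ∀ (F : signedPosetSpan) (l : ℕ), ∃ N₀, ∀ N, N₀ ≤ N →
      countFunctional l N F = (f F).eval (l : ℚ)) (F : signedPosetSpan) (q : ℚ[X])
    (N₁ : ℕ) (hq : ∀ l N : ℕ, N₁ ≤ N → countFunctional l N F = q.eval (l : ℚ)) : f F = q := by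
  refine eq_of_forall_eval_natCast fun l => ?_
  obtain ⟨N₀, hN₀⟩ := hf F l
  rw [← hN₀ (max N₀ N₁) (le_max_left _ _), hq _ _ (le_max_right _ _)]

theorem countFunctional_powerSum {a b : ℕ} (h : (a, b) ≠ (0, 0)) {l N : ℕ} (hN : a + b ≤ N) :
    countFunctional l N (powerSum a b) = 2 * l + 1 := by
  classical
  rw [powerSum, countFunctional, weightedCoeffSum_formalSum _ _ _ (Finset.Icc (-(l : ℤ)) l)]
  · simp
    rw [← Int.cast_natCast, Int.toNat_of_nonneg (by omega)]
    push_cast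
    ring
  · intro i
    rw [mem_monomialBox]
    constructor
    · intro hi
      rw [Finset.mem_Icc] at hi
      refine ⟨fun k hk => ?_, fun k => ?_⟩
      · rw [Finsupp.mem_support_iff, Finsupp.add_apply, Finsupp.single_apply,
          Finsupp.single_apply] at hk
        rw [Finset.mem_Icc]
        split_ifs at hk <;> omega
      · rw [Finsupp.add_apply, Finsupp.single_apply, Finsupp.single_apply]
        split_ifs <;> omega
    · rintro ⟨hs, -⟩
      by_cases ha : a = 0
      · have hb : b ≠ 0 := fun hb => h (by rw [ha, hb])
        have := hs (x := -i) (by simp [ha, hb])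
        simp only [Finset.mem_Icc] at this ⊢
        omega
      · exact hs (by simp [ha])

theorem countFunctional_X_zero {l N : ℕ} (hN : 1 ≤ N) :
    countFunctional l N (MvPowerSeries.X 0) = 1 := by
  classical
  rw [X_zero_eq_formalSum, countFunctional, weightedCoeffSum_formalSum _ _ _ Finset.univ]
  · simp
  · intro _
    simp only [Finset.mem_univ, true_iff]
    rw [mem_monomialBox]
    refine ⟨fun k hk => ?_, fun k => ?_⟩
    · have := Finsupp.support_single_subset hk
      simp_all
    · rw [Finsupp.single_apply]
      split_ifs <;> omega

/-- A linear map that is multiplicative on the `Y_P` is multiplicative. -/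
theorem map_mul_of_forall_Y {f : signedPosetSpan →ₗ[ℚ] ℚ[X]}
    (hf : ∀ p p' : SignedPoset, ∀ h h' h'', f ⟨p.2.2.2.1.Y * p'.2.2.2.1.Y, h⟩ =
      f ⟨p.2.2.2.1.Y, h'⟩ * f ⟨p'.2.2.2.1.Y, h''⟩) (F G : signedPosetSpan) :
    f ⟨(F : MvPowerSeries ℤ ℚ) * G, mul_mem_signedPosetSpan F.2 G.2⟩ = f F * f G := by
  have key : ∀ B : signedPosetSpan →ₗ[ℚ] signedPosetSpan →ₗ[ℚ] ℚ[X],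
      (∀ p p' : SignedPoset, ∀ h h', B ⟨p.2.2.2.1.Y, h⟩ ⟨p'.2.2.2.1.Y, h'⟩ = 0) → B = 0 := by
    have ext : ∀ {M : Type} [AddCommGroup M] [Module ℚ M] (g : signedPosetSpan →ₗ[ℚ] M),
        (∀ p : SignedPoset, ∀ h, g ⟨p.2.2.2.1.Y, h⟩ = 0) → g = 0 := by
      intro M _ _ g hg
      refine LinearMap.ext_on (s := Subtype.val ⁻¹' {F | ∃ (n m : ℕ)
        (S : SignedGraph (Fin n) (Fin m)) (P : S.Orientation), P.Acyclic ∧ F = P.Y})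
        (Submodule.span_span_coe_preimage) ?_
      rintro ⟨_, h⟩ ⟨n, m, S, P, hP, rfl⟩
      exact hg ⟨n, m, S, P, hP⟩ h
    intro B hB
    exact ext B fun p h => ext _ fun p' h' => hB p p' h h'
  let mulB : signedPosetSpan →ₗ[ℚ] signedPosetSpan →ₗ[ℚ] signedPosetSpan :=
    LinearMap.mk₂ ℚ (fun F G => ⟨(F : MvPowerSeries ℤ ℚ) * G, mul_mem_signedPosetSpan F.2 G.2⟩)
      (fun _ _ _ => Subtype.ext (add_mul _ _ _)) (fun _ _ _ => Subtype.ext (smul_mul_assoc _ _ _))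
      (fun _ _ _ => Subtype.ext (mul_add _ _ _)) (fun _ _ _ => Subtype.ext (mul_smul_comm _ _ _))
  have h := key (mulB.compr₂ f - (LinearMap.mul ℚ ℚ[X]).compl₁₂ f f) fun p p' h h' => by
    simp only [LinearMap.sub_apply, LinearMap.compr₂_apply, LinearMap.compl₁₂_apply,
      LinearMap.mul_apply', sub_eq_zero]
    exact hf p p' _ _ _
  have := LinearMap.congr_fun₂ h F G
  simpa [sub_eq_zero, mulB] using this

theorem isChromaticSpecialization_of_countFunctional {f : signedPosetSpan →ₗ[ℚ] ℚ[X]}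
    (hf : ∀ (F : signedPosetSpan) (l : ℕ), ∃ N₀, ∀ N, N₀ ≤ N →
      countFunctional l N F = (f F).eval (l : ℚ)) : IsChromaticSpecialization f where
  map_mul F G := by
    refine ⟨mul_mem_signedPosetSpan F.2 G.2, map_mul_of_forall_Y (fun p p' h h' h'' => ?_) F G⟩
    rw [eval_eq_of_countFunctional hf ⟨_, h'⟩ _ p.1 fun l N hN =>
        countFunctional_Y _ (by simpa using hN),
      eval_eq_of_countFunctional hf ⟨_, h''⟩ _ p'.1 fun l N hN =>
        countFunctional_Y _ (by simpa using hN),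
      ← orderPolynomial_disjointUnion]
    refine eval_eq_of_countFunctional hf _ _ (p.1 + p'.1) fun l N hN => ?_
    rw [← countFunctional_Y _ (N := N) (by simpa using hN), ← Orientation.Y_mul_Y]
  map_powerSum a b h := ⟨powerSum_mem_signedPosetSpan h,
    eval_eq_of_countFunctional hf _ _ (a + b) fun l N hN => by
      simpa using countFunctional_powerSum h hN⟩
  map_x_zero := ⟨X_zero_mem_signedPosetSpan,
    eval_eq_of_countFunctional hf _ _ 1 fun l N hN => by simpa using countFunctional_X_zero hN⟩

/-- The binomial coefficients of the numbers of sinks are values at `-1` of polynomials computed by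
linear functionals, so they satisfy the linear relations among the `Y_P`; hence so do the powers
`t^k = ∑ⱼ (k choose j) (t - 1)^j`. -/
theorem exists_isSinkCounting : ∃ φ : signedPosetSpan →ₗ[ℚ] ℚ[X], IsSinkCounting φ := by
  have hrel : ∀ c : SignedPoset →₀ ℚ,
      Finsupp.linearCombination ℚ (fun p : SignedPoset => p.2.2.2.1.Y) c = 0 →
      Finsupp.linearCombination ℚ
        (fun p : SignedPoset => (X : ℚ[X]) ^ p.2.2.2.1.sinkCount) c = 0 := by
    intro c hc
    refine taylor_injective (1 : ℚ) ?_
    ext j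
    have h := linearCombination_polynomial_eq_zero (Λ := topFunctional j)
      (fun p l N hN => Orientation.topFunctional_Y _ (by simpa using hN)) hc
    have h1 := congrArg (fun q => (-1 : ℚ) ^ j * eval (-1) q) h
    rw [Finsupp.linearCombination_apply, Finsupp.sum] at h1 ⊢
    simp only [eval_finsetSum, eval_smul, smul_eq_mul, eval_zero, mul_zero] at h1
    simp only [map_sum, map_smul, taylor_X_pow, finsetSum_coeff, coeff_smul, smul_eq_mul,
      map_zero, coeff_zero, map_one, coeff_X_add_one_pow]
    rw [← h1, Finset.mul_sum]
    refine Finset.sum_congr rfl fun p _ => ?_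
    rw [Orientation.eval_topPolynomial_neg_one p.2.2.2.2.peelable]
    have : ((-1 : ℚ) ^ j) * (-1) ^ j = 1 := by
      rw [← mul_pow]; simp
    linear_combination (-(c p) * (p.2.2.2.1.sinkCount.choose j)) * this
  obtain ⟨φ, hφ⟩ := exists_linearMap_of_forall_linearCombination_eq_zero _
    signedPosetSpan_eq_span_range hrel
  exact ⟨φ, fun n m S P hP => hφ ⟨n, m, S, P, hP⟩⟩

theorem existsUnique_isSinkCounting :
    ∃! φ : signedPosetSpan →ₗ[ℚ] ℚ[X], IsSinkCounting φ := by
  obtain ⟨φ, hφ⟩ := exists_isSinkCounting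
  refine ⟨φ, hφ, fun ψ hψ => ?_⟩
  refine LinearMap.ext_on (s := Subtype.val ⁻¹' {F | ∃ (n m : ℕ)
    (S : SignedGraph (Fin n) (Fin m)) (P : S.Orientation), P.Acyclic ∧ F = P.Y})
    (Submodule.span_span_coe_preimage) ?_
  rintro ⟨_, h⟩ ⟨n, m, S, P, hP, rfl⟩
  exact (hψ n m S P hP).2.trans (hφ n m S P hP).2.symm

theorem IsSinkCounting.eval_one_Y [Finite E] {φ : signedPosetSpan →ₗ[ℚ] ℚ[X]}
    (hφ : IsSinkCounting φ) {P : S.Orientation} (hP : P.Acyclic) :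
    (φ ⟨P.Y, P.Y_mem_signedPosetSpan hP⟩).eval 1 = 1 := by
  have := Fintype.ofFinite E
  obtain ⟨h, hY⟩ := hφ _ _ _ _ (Orientation.acyclic_relabel hP (Fintype.equivFin V)
    (Fintype.equivFin E).symm)
  have : (⟨P.Y, P.Y_mem_signedPosetSpan hP⟩ : signedPosetSpan) = ⟨_, h⟩ :=
    Subtype.ext (P.Y_relabel _ _).symm
  rw [this, hY]
  simp

end SignedGraph

/-! ### Expansion in the p-basis by deletion and contraction -/

/-- The index of `p_{a,b} = p_{b,a}` in the p-basis, for `(a, b) ≠ (0, 0)`. -/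
def pIndex (a b : ℕ) : PIndex :=
  if h : 0 < a + b then some ⟨(max a b, min a b), by simp; omega, by simp⟩ else none

theorem pBasis_pIndex {a b : ℕ} (h : 0 < a + b) : pBasis (pIndex a b) = powerSum a b := by
  rw [pIndex, dif_pos h, pBasis]
  rcases le_total a b with hab | hab
  · simp only [hab, sup_of_le_right, inf_of_le_left]
    exact powerSum_comm b a
  · simp [hab]

theorem pIndex_eq_some (ab : {ab : ℕ × ℕ // 1 ≤ ab.1 ∧ ab.2 ≤ ab.1}) :
    pIndex ab.1.1 ab.1.2 = some ab := by
  obtain ⟨⟨a, b⟩, h1, h2⟩ := ab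
  rw [pIndex, dif_pos (by simp only at h1 ⊢; omega)]
  simp only at h1 h2
  simp [h2]

/-- The number of factors `p_{a,b}` in a monomial in the elements of the p-basis. -/
noncomputable def powerSumCount : (PIndex →₀ ℕ) →+ ℕ :=
  Finsupp.weight fun i : PIndex => if i.isNone then 0 else 1

theorem powerSumCount_single_none (c : ℕ) : powerSumCount (Finsupp.single none c) = 0 := by
  simp [powerSumCount, Finsupp.weight_single]

theorem powerSumCount_single_pIndex {a b : ℕ} (h : 0 < a + b) :
    powerSumCount (Finsupp.single (pIndex a b) 1) = 1 := by
  simp [powerSumCount, Finsupp.weight_single, pIndex, h]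

/-- The sign of the coefficient of a monomial with `k` factors `p_{a,b}` is `(-1)^(n - k)`, unless
the coefficient vanishes. -/
def SignsAlternate (n : ℕ) (g : MvPolynomial PIndex ℚ) : Prop :=
  ∀ m, 0 ≤ (-1) ^ (n + powerSumCount m) * g.coeff m

theorem SignsAlternate.sub {n : ℕ} {g h : MvPolynomial PIndex ℚ} (hg : SignsAlternate (n + 1) g)
    (hh : SignsAlternate n h) : SignsAlternate (n + 1) (g - h) := fun m => by
  have h1 := hg m
  have h2 := hh m
  rw [MvPolynomial.coeff_sub]
  rw [add_right_comm, pow_succ] at h1 ⊢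
  linarith

section Deletion

variable {V : Type*}

/-- The colorings of the vertices in `W`, extended by `0`, that are proper at the edges in `L`. -/
abbrev ProperOn (W : Finset V) (L : List (V × V × ℤˣ)) : Type _ :=
  {κ : V → ℤ // (∀ v ∉ W, κ v = 0) ∧ ∀ e ∈ L, ¬ IsImproperAt κ e}

/-- The exponent of `x_0^c ∏_{v ∈ W} x_{κ(v)}^{a(v)} x_{-κ(v)}^{b(v)}`. A vertex with weights `a(v)`,
`b(v)` stands for `a(v)` vertices of the color `κ(v)` and `b(v)` vertices of the color `-κ(v)`. -/
noncomputable def contractedMonomial (W : Finset V) (a b : V → ℕ) (c : ℕ) (κ : V → ℤ) : ℤ →₀ ℕ :=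
  Finsupp.single 0 c + ∑ v ∈ W, (Finsupp.single (κ v) (a v) + Finsupp.single (-κ v) (b v))

theorem finiteFibers_contractedMonomial (W : Finset V) (L : List (V × V × ℤˣ)) {a b : V → ℕ}
    (h : ∀ v ∈ W, 0 < a v + b v) (c : ℕ) :
    FiniteFibers fun κ : ProperOn W L => contractedMonomial W a b c κ.1 := fun m => by
  classical
  have hle : ∀ (κ : {κ : ProperOn W L // contractedMonomial W a b c κ.1 = m}), ∀ v ∈ W,
      |κ.1.1 v| ∈ m.support.image abs := by
    rintro ⟨κ, rfl⟩ v hv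
    have h1 : Finsupp.single (κ.1 v) (a v) + Finsupp.single (-κ.1 v) (b v) ≤
        contractedMonomial W a b c κ.1 :=
      (Finset.single_le_sum (f := fun v => Finsupp.single (κ.1 v) (a v) +
        Finsupp.single (-κ.1 v) (b v)) (fun _ _ => zero_le) hv).trans le_add_self
    have h2 := h v hv
    rw [Finset.mem_image]
    by_cases ha : a v = 0
    · refine ⟨-κ.1 v, Finsupp.mem_support_iff.2 fun h0 => ?_, abs_neg _⟩
      have := h1 (-κ.1 v)
      rw [h0, Finsupp.add_apply, Finsupp.single_eq_same] at this
      omega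
    · refine ⟨κ.1 v, Finsupp.mem_support_iff.2 fun h0 => ?_, rfl⟩
      have := h1 (κ.1 v)
      rw [h0, Finsupp.add_apply, Finsupp.single_eq_same] at this
      omega
  refine Finite.of_injective (β := W → Finset.Icc (-∑ i ∈ m.support, |i|) (∑ i ∈ m.support, |i|))
    (fun κ v => ⟨κ.1.1 v, ?_⟩) ?_
  · obtain ⟨i, hi, hi'⟩ := Finset.mem_image.1 (hle κ v v.2)
    have h1 := Finset.single_le_sum (f := fun i : ℤ => |i|) (fun _ _ => abs_nonneg _) hi
    rw [Finset.mem_Icc, ← abs_le, ← hi']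
    exact h1
  · intro κ κ' hκ
    refine Subtype.ext (Subtype.ext (funext fun v => ?_))
    by_cases hv : v ∈ W
    · exact congrArg Subtype.val (congrFun hκ ⟨v, hv⟩)
    · rw [κ.1.2.1 v hv, κ'.1.2.1 v hv]

theorem finiteFibers_powerSum {a b : ℕ} (h : 0 < a + b) :
    FiniteFibers fun i : ℤ => Finsupp.single i a + Finsupp.single (-i) b := fun m => by
  have := finiteFibers_contractedMonomial {()} [] (a := fun _ => a) (b := fun _ => b)
    (fun _ _ => h) 0 m
  refine Finite.of_injective (fun i => (⟨⟨fun _ => i.1, by simp⟩, by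
    simpa [contractedMonomial] using i.2⟩ : {κ : ProperOn {()} [] //
      contractedMonomial {()} (fun _ => a) (fun _ => b) 0 κ.1 = m})) fun i j hij => ?_
  have := congrArg (fun κ => κ.1.1 ()) hij
  exact Subtype.ext this

/-- A product of elements of the p-basis, as a sum over all colorings of a set of weighted vertices. -/
theorem aeval_pBasis_monomial (W : Finset V) {a b : V → ℕ} (h : ∀ v ∈ W, 0 < a v + b v) (c : ℕ) :
    MvPolynomial.aeval pBasis (MvPolynomial.monomial
      (Finsupp.single none c + ∑ v ∈ W, Finsupp.single (pIndex (a v) (b v)) 1) (1 : ℚ)) =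
    formalSum fun κ : ProperOn W [] => contractedMonomial W a b c κ.1 := by
  classical
  have hX : ∀ i : PIndex, MvPolynomial.monomial (Finsupp.single i 1) (1 : ℚ) = MvPolynomial.X i :=
    fun _ => rfl
  induction W using Finset.induction_on with
  | empty =>
    have : Unique (ProperOn (∅ : Finset V) []) :=
      ⟨⟨⟨0, by simp⟩⟩, fun κ => Subtype.ext (funext fun v => κ.2.1 v (by simp))⟩
    rw [formalSum_unique, Finset.sum_empty, add_zero, ← MvPolynomial.X_pow_eq_monomial, map_pow,
      MvPolynomial.aeval_X, pBasis, MvPowerSeries.X_pow_eq]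
    simp [contractedMonomial]
  | insert w W hw ih =>
    have hW : ∀ v ∈ W, 0 < a v + b v := fun v hv => h v (Finset.mem_insert_of_mem hv)
    have hw0 := h w (Finset.mem_insert_self w W)
    rw [Finset.sum_insert hw, add_left_comm, ← one_mul (1 : ℚ), ← MvPolynomial.monomial_mul,
      map_mul, hX, MvPolynomial.aeval_X, ih hW, pBasis_pIndex hw0, powerSum,
      formalSum_mul (finiteFibers_powerSum hw0) (finiteFibers_contractedMonomial W [] hW c)]
    refine formalSum_equiv ⟨fun p => ⟨Function.update p.2.1 w p.1, ?_, by simp⟩,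
      fun κ => ⟨κ.1 w, Function.update κ.1 w 0, ?_, by simp⟩, ?_, ?_⟩ ?_
    · intro v hv
      rw [Finset.mem_insert, not_or] at hv
      rw [Function.update_of_ne hv.1, p.2.2.1 v hv.2]
    · intro v hv
      by_cases hvw : v = w
      · rw [hvw, Function.update_self]
      · rw [Function.update_of_ne hvw]
        exact κ.2.1 v (by simp [hvw, hv])
    · rintro ⟨i, κ, hκ⟩
      have := hκ.1 w hw
      simp only [Function.update_self, Function.update_idem, Prod.mk.injEq, true_and]
      exact Subtype.ext ((congrArg (Function.update κ w) this.symm).trans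
        (Function.update_eq_self w κ))
    · rintro ⟨κ, hκ⟩
      simp
    · rintro ⟨i, κ, hκ⟩
      simp only [contractedMonomial, Equiv.coe_fn_mk]
      rw [Finset.sum_insert hw, Function.update_self, add_left_comm]
      congr 2
      refine Finset.sum_congr rfl fun v hv => ?_
      rw [Function.update_of_ne (ne_of_mem_of_not_mem hv hw)]

theorem formalSum_cons {W : Finset V} (L : List (V × V × ℤˣ)) (e : V × V × ℤˣ) {a b : V → ℕ}
    (h : ∀ v ∈ W, 0 < a v + b v) (c : ℕ) :
    (formalSum fun κ : ProperOn W (e :: L) => contractedMonomial W a b c κ.1) =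
      (formalSum fun κ : ProperOn W L => contractedMonomial W a b c κ.1) -
      formalSum fun κ : {κ : ProperOn W L // IsImproperAt κ.1 e} =>
        contractedMonomial W a b c κ.1.1 := by
  rw [formalSum_eq_add (finiteFibers_contractedMonomial W L h c) fun κ => IsImproperAt κ.1 e,
    add_sub_cancel_left]
  symm
  refine formalSum_equiv (Equiv.trans (Equiv.subtypeSubtypeEquivSubtypeInter
    (fun κ => (∀ v ∉ W, κ v = 0) ∧ ∀ e ∈ L, ¬ IsImproperAt κ e) fun κ => ¬ IsImproperAt κ e)
    (Equiv.subtypeEquivRight fun κ => ?_)) ?_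
  · simp only [List.mem_cons, forall_eq_or_imp]
    tauto
  · exact fun κ => rfl

section Contraction

variable [DecidableEq V]

/-- The edge `e` after the vertex `u` has been replaced by the vertex `v`, whose color multiplied by `ε`
is the color of `u`. -/
def contractEdge (u v : V) (ε : ℤˣ) (e : V × V × ℤˣ) : V × V × ℤˣ :=
  (if e.1 = u then v else e.1, if e.2.1 = u then v else e.2.1,
    (if e.1 = u then ε else 1) * e.2.2 * (if e.2.1 = u then ε else 1))

theorem isImproperAt_contractEdge {u v : V} {ε : ℤˣ} {κ κ' : V → ℤ} (hu : κ u = ε * κ' v)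
    (hκ : ∀ x, x ≠ u → κ x = κ' x) (e : V × V × ℤˣ) :
    IsImproperAt κ' (contractEdge u v ε e) ↔ IsImproperAt κ e := by
  obtain ⟨x, y, δ⟩ := e
  have hs : ∀ x, κ x = ((if x = u then ε else 1 : ℤˣ) : ℤ) * κ' (if x = u then v else x) := by
    intro x
    split_ifs with h
    · rw [h, hu]
    · simp [hκ x h]
  simp only [IsImproperAt, contractEdge, hs x, hs y]
  rcases Int.units_eq_one_or (if x = u then ε else 1) with h | h <;> rw [h]
  · simp only [Units.val_mul, Units.val_one, one_mul, mul_assoc]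
  · simp only [Units.val_mul, Units.val_neg, Units.val_one]
    constructor <;> intro h <;> linarith

/-- Contraction of an edge at which the coloring is improper if and only if `w` has color `0`. -/
theorem formalSum_contract_zero {W : Finset V} {L : List (V × V × ℤˣ)} {e : V × V × ℤˣ} {w : V}
    (hw : w ∈ W) (he : ∀ κ : V → ℤ, (∀ v ∉ W, κ v = 0) → (IsImproperAt κ e ↔ κ w = 0))
    (a b : V → ℕ) (c : ℕ) :
    (formalSum fun κ : {κ : ProperOn W L // IsImproperAt κ.1 e} =>
        contractedMonomial W a b c κ.1.1) =
      formalSum fun κ : ProperOn (W.erase w) L =>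
        contractedMonomial (W.erase w) a b (c + (a w + b w)) κ.1 := by
  refine formalSum_equiv (Equiv.trans (Equiv.subtypeSubtypeEquivSubtypeInter
    (fun κ => (∀ v ∉ W, κ v = 0) ∧ ∀ e ∈ L, ¬ IsImproperAt κ e) fun κ => IsImproperAt κ e)
    (Equiv.subtypeEquivRight fun κ => ?_)) ?_
  · constructor
    · rintro ⟨⟨h1, h2⟩, h3⟩
      refine ⟨fun v hv => ?_, h2⟩
      by_cases hvw : v = w
      · rw [hvw]
        exact (he κ h1).1 h3
      · exact h1 v fun h => hv (Finset.mem_erase.2 ⟨hvw, h⟩)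
    · rintro ⟨h1, h2⟩
      have h3 : ∀ v ∉ W, κ v = 0 := fun v hv => h1 v fun h => hv (Finset.mem_of_mem_erase h)
      exact ⟨⟨h3, h2⟩, (he κ h3).2 (h1 w (Finset.notMem_erase w W))⟩
  · rintro ⟨⟨κ, h1, h2⟩, h3⟩
    have hκw := (he κ h1).1 h3
    change contractedMonomial (W.erase w) a b (c + (a w + b w)) κ = contractedMonomial W a b c κ
    rw [contractedMonomial, contractedMonomial, ← Finset.add_sum_erase _ _ hw, hκw, neg_zero,
      Finsupp.single_add, Finsupp.single_add, add_assoc]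

/-- Contraction of an edge between two vertices: the vertex `u` is merged into `v`. -/
theorem formalSum_contract {W : Finset V} {L : List (V × V × ℤˣ)} {u v : V} {ε : ℤˣ}
    (hu : u ∈ W) (hv : v ∈ W) (huv : u ≠ v) (a b : V → ℕ) (c : ℕ) :
    (formalSum fun κ : {κ : ProperOn W L // IsImproperAt κ.1 (u, v, ε)} =>
        contractedMonomial W a b c κ.1.1) =
      formalSum fun κ : ProperOn (W.erase u) (L.map (contractEdge u v ε)) =>
        contractedMonomial (W.erase u) (a + Pi.single v (if ε = 1 then a u else b u))
          (b + Pi.single v (if ε = 1 then b u else a u)) c κ.1 := by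
  have hedge : ∀ κ κ' : V → ℤ, κ u = ε * κ' v → (∀ x, x ≠ u → κ x = κ' x) →
      ((∀ e ∈ L.map (contractEdge u v ε), ¬ IsImproperAt κ' e) ↔
        ∀ e ∈ L, ¬ IsImproperAt κ e) := by
    intro κ κ' h1 h2
    rw [List.forall_mem_map]
    simp only [isImproperAt_contractEdge h1 h2]
  refine formalSum_equiv ⟨fun κ => ⟨Function.update κ.1.1 u 0, fun x hx => ?_, ?_⟩,
    fun κ => ⟨⟨Function.update κ.1 u (ε * κ.1 v), fun x hx => ?_, ?_⟩, ?_⟩, ?_, ?_⟩ ?_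
  · by_cases hxu : x = u
    · rw [hxu, Function.update_self]
    · rw [Function.update_of_ne hxu]
      exact κ.1.2.1 x fun h => hx (Finset.mem_erase.2 ⟨hxu, h⟩)
  · refine (hedge κ.1.1 _ ?_ fun x hx => ?_).2 κ.1.2.2
    · rw [Function.update_of_ne huv.symm]
      exact κ.2
    · rw [Function.update_of_ne hx]
  · rw [Function.update_of_ne (ne_of_mem_of_not_mem hu hx).symm]
    exact κ.2.1 x fun h => hx (Finset.mem_of_mem_erase h)
  · exact (hedge _ κ.1 (by rw [Function.update_self]) fun x hx => by
      rw [Function.update_of_ne hx]).1 κ.2.2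
  · simp only [IsImproperAt]
    rw [Function.update_self, Function.update_of_ne huv.symm]
  · rintro ⟨⟨κ, h1, h2⟩, h3⟩
    refine Subtype.ext (Subtype.ext ?_)
    simp only [Function.update_idem]
    rw [Function.update_of_ne huv.symm, ← show κ u = ε * κ v from h3]
    exact Function.update_eq_self u κ
  · rintro ⟨κ, h1, h2⟩
    refine Subtype.ext ?_
    simp only [Function.update_idem]
    rw [← h1 u (Finset.notMem_erase u W)]
    exact Function.update_eq_self u κ
  · rintro ⟨⟨κ, h1, h2⟩, h3⟩
    have h3 : κ u = ε * κ v := h3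
    simp only [Equiv.coe_fn_mk, contractedMonomial]
    congr 1
    have hv' := Finset.mem_erase.2 ⟨huv.symm, hv⟩
    rw [← Finset.add_sum_erase W _ hu, ← Finset.add_sum_erase _ _ hv',
      ← Finset.add_sum_erase _ _ hv', ← add_assoc]
    congr 1
    · simp only [Function.update_of_ne huv.symm, Pi.add_apply, Pi.single_eq_same, h3,
        Finsupp.single_add]
      rcases Int.units_eq_one_or ε with rfl | rfl
      · simp only [if_true, Units.val_one, one_mul]
        abel
      · simp only [if_neg (show ¬ (-1 : ℤˣ) = 1 by decide), Units.val_neg, Units.val_one, neg_mul,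
          one_mul, neg_neg]
        abel
    · refine Finset.sum_congr rfl fun x hx => ?_
      have hx1 : x ≠ v := Finset.ne_of_mem_erase hx
      have hx2 : x ≠ u := Finset.ne_of_mem_erase (Finset.mem_of_mem_erase hx)
      simp [hx1, hx2]

/-- Deletion and contraction express the generating function as a polynomial in the p-basis. A
contraction lowers the number of vertices by one and enters with a minus sign, so the signs
alternate with the number of factors `p_{a,b}`. -/
theorem exists_signsAlternate (L : List (V × V × ℤˣ)) (W : Finset V) (a b : V → ℕ)
    (h : ∀ v ∈ W, 0 < a v + b v) (c : ℕ) :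
    ∃ g : MvPolynomial PIndex ℚ, MvPolynomial.aeval pBasis g =
      (formalSum fun κ : ProperOn W L => contractedMonomial W a b c κ.1) ∧
      SignsAlternate W.card g := by
  obtain ⟨n, hn⟩ : ∃ n, L.length = n := ⟨_, rfl⟩
  induction n generalizing L W a b c with
  | zero =>
    obtain rfl := List.length_eq_zero_iff.1 hn
    refine ⟨_, aeval_pBasis_monomial W h c, fun m => ?_⟩
    rw [MvPolynomial.coeff_monomial]
    split_ifs with hm
    · rw [← hm, map_add, map_sum, powerSumCount_single_none,
        Finset.sum_congr rfl fun v hv => powerSumCount_single_pIndex (h v hv)]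
      simp [← two_mul]
    · simp
  | succ n ih =>
    cases L with
    | nil => simp at hn
    | cons e L =>
      have hL : L.length = n := by simpa using hn
      have hzero : (∀ κ : V → ℤ, (∀ v ∉ W, κ v = 0) → IsImproperAt κ e) →
          ∃ g : MvPolynomial PIndex ℚ, MvPolynomial.aeval pBasis g =
            (formalSum fun κ : ProperOn W (e :: L) => contractedMonomial W a b c κ.1) ∧
            SignsAlternate W.card g := by
        intro he
        have : IsEmpty (ProperOn W (e :: L)) :=
          ⟨fun κ => κ.2.2 e (by simp) (he κ.1 κ.2.1)⟩
        exact ⟨0, by rw [formalSum_of_isEmpty, map_zero], fun m => by simp⟩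
      have hcon : ∀ w ∈ W, ∀ (L' : List (V × V × ℤˣ)) (a' b' : V → ℕ) (c' : ℕ), L'.length = n →
          (∀ v ∈ W.erase w, 0 < a' v + b' v) →
          ((formalSum fun κ : {κ : ProperOn W L // IsImproperAt κ.1 e} =>
            contractedMonomial W a b c κ.1.1) =
          formalSum fun κ : ProperOn (W.erase w) L' =>
            contractedMonomial (W.erase w) a' b' c' κ.1) →
          ∃ g : MvPolynomial PIndex ℚ, MvPolynomial.aeval pBasis g =
            (formalSum fun κ : ProperOn W (e :: L) => contractedMonomial W a b c κ.1) ∧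
            SignsAlternate W.card g := by
        intro w hw L' a' b' c' hL' h' heq
        obtain ⟨g, hg, hg'⟩ := ih L W a b h c hL
        obtain ⟨g₁, hg₁, hg₁'⟩ := ih L' (W.erase w) a' b' h' c' hL'
        refine ⟨g - g₁, by rw [map_sub, hg, hg₁, formalSum_cons L e h c, heq], ?_⟩
        rw [← Finset.card_erase_add_one hw] at hg' ⊢
        exact hg'.sub hg₁'
      have hcon0 : ∀ w ∈ W, (∀ κ : V → ℤ, (∀ v ∉ W, κ v = 0) → (IsImproperAt κ e ↔ κ w = 0)) →
          ∃ g : MvPolynomial PIndex ℚ, MvPolynomial.aeval pBasis g =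
            (formalSum fun κ : ProperOn W (e :: L) => contractedMonomial W a b c κ.1) ∧
            SignsAlternate W.card g := fun w hw he =>
        hcon w hw L a b _ hL (fun v hv => h v (Finset.mem_of_mem_erase hv))
          (formalSum_contract_zero hw he a b c)
      obtain ⟨u, v, ε⟩ := e
      by_cases hu : u ∈ W <;> by_cases hv : v ∈ W
      · by_cases huv : u = v
        · subst huv
          rcases Int.units_eq_one_or ε with rfl | rfl
          · exact hzero fun κ _ => by simp [IsImproperAt]
          · refine hcon0 u hu fun κ _ => ?_
            simp only [IsImproperAt, Units.val_neg, Units.val_one]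
            omega
        · refine hcon u hu _ _ _ _ (by simpa using hL) (fun x hx => ?_)
            (formalSum_contract hu hv huv a b c)
          have := h x (Finset.mem_of_mem_erase hx)
          simp only [Pi.add_apply]
          omega
      · exact hcon0 u hu fun κ hκ => by simp [IsImproperAt, hκ v hv]
      · exact hcon0 v hv fun κ hκ => by
          simp [IsImproperAt, hκ u hu, eq_comm]
      · exact hzero fun κ hκ => by simp [IsImproperAt, hκ u hu, hκ v hv]

end Contraction

theorem SignedGraph.exists_aeval_pBasis_eq_chromaticB {E : Type*} [Fintype V] [Finite E]
    (S : SignedGraph V E) : ∃ g : MvPolynomial PIndex ℚ,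
      MvPolynomial.aeval pBasis g = S.chromaticB ∧ SignsAlternate (Fintype.card V) g := by
  classical
  have := Fintype.ofFinite E
  obtain ⟨g, hg, hg'⟩ := exists_signsAlternate
    (Finset.univ.toList.map fun e => (S.ends e true, S.ends e false, S.sgn e)) Finset.univ
    (fun _ => 1) (fun _ => 0) (fun _ _ => by simp) 0
  refine ⟨g, hg.trans (formalSum_equiv (Equiv.subtypeEquivRight fun κ => ?_) fun κ => ?_), hg'⟩
  · simp [IsImproperAt, SignedGraph.IsProper]
  · simp [contractedMonomial, colorMonomial]
    rfl

end Deletion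

/-! ### Algebraic independence of the p-basis -/

/-- Every exponent of a monomial in the p-basis is given by a power of `x_0` and a sequence of factors
`p_{a,b}`. -/
theorem exists_eq_single_none_add_sum (d : PIndex →₀ ℕ) :
    ∃ (k : ℕ) (q : Fin k → {ab : ℕ × ℕ // 1 ≤ ab.1 ∧ ab.2 ≤ ab.1}) (c : ℕ),
      d = Finsupp.single none c + ∑ j, Finsupp.single (some (q j)) 1 := by
  induction d using Finsupp.induction_linear with
  | zero => exact ⟨0, Fin.elim0, 0, by simp⟩
  | add d d' h h' =>
    obtain ⟨k, q, c, rfl⟩ := h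
    obtain ⟨k', q', c', rfl⟩ := h'
    refine ⟨k + k', Fin.append q q', c + c', ?_⟩
    rw [Fin.sum_univ_add, Finsupp.single_add]
    simp only [Fin.append_left, Fin.append_right]
    abel
  | single i n =>
    cases i with
    | none => exact ⟨0, Fin.elim0, n, by simp⟩
    | some ab => exact ⟨n, fun _ => ab, 0, by simp⟩

theorem powerSumCount_eq {k : ℕ} (q : Fin k → {ab : ℕ × ℕ // 1 ≤ ab.1 ∧ ab.2 ≤ ab.1}) (c : ℕ) :
    powerSumCount (Finsupp.single none c + ∑ j, Finsupp.single (some (q j)) 1) = k := by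
  rw [map_add, map_sum, powerSumCount_single_none]
  simp [powerSumCount, Finsupp.weight_single]

theorem contractedMonomial_apply_of_abs_eq {k : ℕ} (a b : Fin k → ℕ) (c : ℕ) {κ : Fin k → ℤ}
    (hκ : ∀ j, κ j = (j : ℤ) + 1 ∨ κ j = -((j : ℤ) + 1)) (j : Fin k) :
    contractedMonomial Finset.univ a b c κ (κ j) = a j ∧
      contractedMonomial Finset.univ a b c κ (-κ j) = b j := by
  have hne : ∀ i, i ≠ j → κ i ≠ κ j ∧ κ i ≠ -κ j := fun i hi => by
    have := Fin.val_ne_of_ne hi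
    have := hκ i
    have := hκ j
    omega
  have h0 : κ j ≠ 0 ∧ -κ j ≠ 0 ∧ κ j ≠ -κ j := by
    have := hκ j
    omega
  simp only [contractedMonomial, Finsupp.add_apply, Finsupp.finsetSum_apply]
  constructor
  · rw [Finset.sum_eq_single j]
    · rw [Finsupp.single_eq_of_ne h0.1, Finsupp.single_eq_same, Finsupp.single_eq_of_ne h0.2.2]
      simp
    · intro i _ hi
      have := hne i hi
      rw [Finsupp.single_eq_of_ne this.1.symm, Finsupp.single_eq_of_ne (by omega), add_zero]
    · simp
  · rw [Finset.sum_eq_single j]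
    · rw [Finsupp.single_eq_of_ne h0.2.1, Finsupp.single_eq_same,
        Finsupp.single_eq_of_ne h0.2.2.symm]
      simp
    · intro i _ hi
      have := hne i hi
      rw [Finsupp.single_eq_of_ne this.2.symm, Finsupp.single_eq_of_ne (by omega), add_zero]
    · simp

theorem contractedMonomial_apply_zero {k : ℕ} (a b : Fin k → ℕ) (c : ℕ) {κ : Fin k → ℤ}
    (hκ : ∀ j, κ j ≠ 0) : contractedMonomial Finset.univ a b c κ 0 = c := by
  simp only [contractedMonomial, Finsupp.add_apply, Finsupp.finsetSum_apply,
    Finsupp.single_eq_same]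
  rw [Finset.sum_eq_zero, add_zero]
  intro j _
  rw [Finsupp.single_eq_of_ne (hκ j).symm, Finsupp.single_eq_of_ne (by have := hκ j; omega),
    add_zero]

/-- The monomial `x_0^c ∏_j x_j^{a_j} x_{-j}^{b_j}`, with `k` factors, occurs in no product of at most `k`
elements `p_{a,b}` and a power of `x_0` but in `x_0^c ∏_j p_{a_j,b_j}`: every factor has to account for
one of the indices `j`. -/
theorem eq_of_contractedMonomial_eq {k k' : ℕ} (hk : k' ≤ k)
    {q : Fin k → {ab : ℕ × ℕ // 1 ≤ ab.1 ∧ ab.2 ≤ ab.1}}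
    {q' : Fin k' → {ab : ℕ × ℕ // 1 ≤ ab.1 ∧ ab.2 ≤ ab.1}} {c c' : ℕ} {κ : Fin k' → ℤ}
    (h : contractedMonomial Finset.univ (fun j => (q' j).1.1) (fun j => (q' j).1.2) c' κ =
      contractedMonomial Finset.univ (fun j => (q j).1.1) (fun j => (q j).1.2) c
        fun j => (j : ℤ) + 1) :
    (Finsupp.single none c' + ∑ j, Finsupp.single (some (q' j)) 1 : PIndex →₀ ℕ) =
      Finsupp.single none c + ∑ j, Finsupp.single (some (q j)) 1 := by
  have hstd := contractedMonomial_apply_of_abs_eq (fun j => (q j).1.1) (fun j => (q j).1.2) c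
    (κ := fun j : Fin k => (j : ℤ) + 1) fun j => Or.inl rfl
  have hstd0 := contractedMonomial_apply_zero (fun j => (q j).1.1) (fun j => (q j).1.2) c
    (κ := fun j : Fin k => (j : ℤ) + 1) fun j => by omega
  have hex : ∀ j : Fin k, ∃ i, κ i = (j : ℤ) + 1 ∨ κ i = -((j : ℤ) + 1) := by
    intro j
    by_contra! hcon
    have h1 := (hstd j).1
    rw [← h] at h1
    simp only [contractedMonomial, Finsupp.add_apply, Finsupp.finsetSum_apply] at h1
    rw [Finsupp.single_eq_of_ne (by omega), Finset.sum_eq_zero] at h1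
    · have := (q j).2.1
      omega
    · intro i _
      have := hcon i
      rw [Finsupp.single_eq_of_ne (by omega), Finsupp.single_eq_of_ne (by omega), add_zero]
  choose e he using hex
  have hinj : Function.Injective e := fun i j hij => by
    have h1 := he i
    have h2 := he j
    rw [hij] at h1
    exact Fin.ext (by omega)
  obtain rfl : k = k' := le_antisymm (by simpa using Fintype.card_le_of_injective e hinj) hk
  let π : Fin k ≃ Fin k := Equiv.ofBijective e (Finite.injective_iff_bijective.1 hinj)
  have h' : contractedMonomial Finset.univ (fun j => (q' (e j)).1.1) (fun j => (q' (e j)).1.2) c'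
      (κ ∘ e) = contractedMonomial Finset.univ (fun j => (q j).1.1) (fun j => (q j).1.2) c
        fun j => (j : ℤ) + 1 := by
    rw [← h, contractedMonomial, contractedMonomial]
    congr 1
    exact π.sum_comp fun i => Finsupp.single (κ i) (q' i).1.1 + Finsupp.single (-κ i) (q' i).1.2
  have hκ := contractedMonomial_apply_of_abs_eq (fun j => (q' (e j)).1.1)
    (fun j => (q' (e j)).1.2) c' (κ := κ ∘ e) he
  have hκ0 := contractedMonomial_apply_zero (fun j => (q' (e j)).1.1)
    (fun j => (q' (e j)).1.2) c' (κ := κ ∘ e) fun j => by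
      have := he j
      simp only [Function.comp_apply]
      omega
  rw [h'] at hκ hκ0
  have hc : c' = c := hκ0.symm.trans hstd0
  have hq : ∀ j, q' (e j) = q j := by
    intro j
    obtain ⟨h1, h2⟩ := hκ j
    obtain ⟨h3, h4⟩ := hstd j
    have h5 := (q j).2.2
    have h6 := (q' (e j)).2.2
    simp only [Function.comp_apply] at h1 h2
    refine Subtype.ext (Prod.ext ?_ ?_) <;>
    · rcases he j with h7 | h7 <;> rw [h7] at h1 h2
      · omega
      · rw [neg_neg] at h2
        omega
  rw [hc]
  congr 1
  rw [← π.sum_comp]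
  exact Finset.sum_congr rfl fun j _ => congrArg (fun x => Finsupp.single (some x) 1) (hq j)

theorem algebraicIndependent_pBasis : AlgebraicIndependent ℚ pBasis := by
  rw [algebraicIndependent_iff]
  intro g hg
  by_contra hne
  obtain ⟨s, hs, hmax⟩ := Finset.exists_max_image g.support powerSumCount
    (MvPolynomial.support_nonempty.2 hne)
  obtain ⟨k, q, c, rfl⟩ := exists_eq_single_none_add_sum s
  have hform : ∀ (k : ℕ) (q : Fin k → {ab : ℕ × ℕ // 1 ≤ ab.1 ∧ ab.2 ≤ ab.1}) (c : ℕ),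
      MvPolynomial.aeval pBasis (MvPolynomial.monomial
        (Finsupp.single none c + ∑ j, Finsupp.single (some (q j)) 1) (1 : ℚ)) =
      formalSum fun κ : ProperOn (Finset.univ : Finset (Fin k)) [] =>
        contractedMonomial Finset.univ (fun j => (q j).1.1) (fun j => (q j).1.2) c κ.1 := by
    intro k q c
    rw [← aeval_pBasis_monomial _ fun j _ => Nat.add_pos_left (q j).2.1 _]
    simp only [pIndex_eq_some]
  have h0 := congrArg (MvPowerSeries.coeff (contractedMonomial Finset.univ
    (fun j => (q j).1.1) (fun j => (q j).1.2) c fun j : Fin k => (j : ℤ) + 1)) hg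
  rw [g.as_sum, map_sum, map_sum, Finset.sum_eq_single _ _ fun h => absurd hs h] at h0
  · rw [← mul_one (MvPolynomial.coeff _ g), ← smul_eq_mul, ← MvPolynomial.smul_monomial, map_smul,
      hform, map_smul, coeff_formalSum, map_zero, smul_eq_mul, mul_eq_zero] at h0
    refine h0.elim (MvPolynomial.mem_support_iff.1 hs) fun h1 => ?_
    have := finiteFibers_contractedMonomial (Finset.univ : Finset (Fin k)) []
      (fun j _ => Nat.add_pos_left (q j).2.1 (q j).1.2) c (contractedMonomial Finset.univ
        (fun j => (q j).1.1) (fun j => (q j).1.2) c fun j : Fin k => (j : ℤ) + 1)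
    rw [Nat.cast_eq_zero, Nat.card_eq_zero] at h1
    refine h1.elim (fun h => h.false ⟨⟨fun j => (j : ℤ) + 1, by simp⟩, rfl⟩) fun h => ?_
    exact not_finite_iff_infinite.2 h this
  · intro s' hs' hss'
    obtain ⟨k', q', c', rfl⟩ := exists_eq_single_none_add_sum s'
    have hk := hmax _ hs'
    rw [powerSumCount_eq, powerSumCount_eq] at hk
    rw [← mul_one (MvPolynomial.coeff _ g), ← smul_eq_mul, ← MvPolynomial.smul_monomial, map_smul,
      hform, map_smul, coeff_formalSum]
    have : IsEmpty {κ : ProperOn (Finset.univ : Finset (Fin k')) [] //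
        contractedMonomial Finset.univ (fun j => (q' j).1.1) (fun j => (q' j).1.2) c' κ.1 =
        contractedMonomial Finset.univ (fun j => (q j).1.1) (fun j => (q j).1.2) c
          fun j => (j : ℤ) + 1} :=
      ⟨fun κ => hss' (eq_of_contractedMonomial_eq hk κ.2)⟩
    simp

/-! ### Evaluation at `-1` -/

namespace SignedGraph

/-- A chromatic specialization is determined on the polynomials in the p-basis. -/
theorem IsChromaticSpecialization.map_aeval_pBasis {f : signedPosetSpan →ₗ[ℚ] ℚ[X]}
    (hf : IsChromaticSpecialization f) (g : MvPolynomial PIndex ℚ) :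
    ∃ h : MvPolynomial.aeval pBasis g ∈ signedPosetSpan, f ⟨_, h⟩ =
      MvPolynomial.aeval (fun i : PIndex => if i.isNone then (1 : ℚ[X]) else 2 * X + 1) g := by
  obtain ⟨h0, hx⟩ := hf.map_x_zero
  have hone : f ⟨1, one_mem_signedPosetSpan⟩ = 1 := by
    obtain ⟨h1, h2⟩ := hf.map_mul ⟨1, one_mem_signedPosetSpan⟩ ⟨_, h0⟩
    simp only [one_mul] at h2
    rwa [hx, mul_one, eq_comm] at h2
  induction g using MvPolynomial.induction_on with
  | C r =>
    have : MvPolynomial.aeval pBasis (MvPolynomial.C r) = r • (1 : MvPowerSeries ℤ ℚ) := by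
      rw [MvPolynomial.aeval_C, Algebra.algebraMap_eq_smul_one]
    have hmem : r • (1 : MvPowerSeries ℤ ℚ) ∈ signedPosetSpan :=
      Submodule.smul_mem _ _ one_mem_signedPosetSpan
    simp only [this]
    refine ⟨hmem, ?_⟩
    have h2 : (⟨_, hmem⟩ : signedPosetSpan) = r • ⟨1, one_mem_signedPosetSpan⟩ := rfl
    rw [h2, map_smul, hone, MvPolynomial.aeval_C, Algebra.algebraMap_eq_smul_one]
  | add g g' h h' =>
    obtain ⟨h1, h2⟩ := h
    obtain ⟨h3, h4⟩ := h'
    simp only [map_add]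
    refine ⟨Submodule.add_mem _ h1 h3, ?_⟩
    rw [← h2, ← h4]
    exact map_add f ⟨_, h1⟩ ⟨_, h3⟩
  | mul_X g i h =>
    obtain ⟨h1, h2⟩ := h
    have hi : ∃ h : pBasis i ∈ signedPosetSpan, f ⟨_, h⟩ =
        if i.isNone then (1 : ℚ[X]) else 2 * X + 1 := by
      cases i with
      | none => exact hf.map_x_zero
      | some ab =>
        exact hf.map_powerSum _ _ fun h => by
          have := ab.2.1
          simp_all
    obtain ⟨h3, h4⟩ := hi
    simp only [map_mul, MvPolynomial.aeval_X]
    refine ⟨mul_mem_signedPosetSpan h1 h3, ?_⟩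
    rw [← h2, ← h4]
    exact (hf.map_mul ⟨_, h1⟩ ⟨_, h3⟩).2

theorem eval_neg_one_aeval (g : MvPolynomial PIndex ℚ) :
    (MvPolynomial.aeval (fun i : PIndex => if i.isNone then (1 : ℚ[X]) else 2 * X + 1) g).eval
      (-1) = ∑ m ∈ g.support, g.coeff m * (-1) ^ powerSumCount m := by
  rw [MvPolynomial.aeval_def, MvPolynomial.eval₂_eq, eval_finsetSum]
  refine Finset.sum_congr rfl fun m _ => ?_
  rw [eval_mul, eval_prod, Polynomial.algebraMap_eq, eval_C]
  congr 1
  have : ∀ i : PIndex, eval (-1) ((if i.isNone then (1 : ℚ[X]) else 2 * X + 1) ^ m i) =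
      (-1) ^ (m i * if i.isNone then 0 else 1) := by
    intro i
    cases i
    · simp
    · norm_num
  simp only [this]
  rw [Finset.prod_pow_eq_pow_sum]
  congr 1

/-- If the signs alternate, then the absolute values of the coefficients are added up by the value
at `-1`. -/
theorem sum_abs_coeff_of_signsAlternate {n : ℕ} {g : MvPolynomial PIndex ℚ}
    (hg : SignsAlternate n g) : ∑ m ∈ g.support, |g.coeff m| = (-1) ^ n *
      (MvPolynomial.aeval (fun i : PIndex => if i.isNone then (1 : ℚ[X]) else 2 * X + 1) g).eval
        (-1) := by
  rw [eval_neg_one_aeval, Finset.mul_sum]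
  refine Finset.sum_congr rfl fun m _ => ?_
  rw [mul_comm (g.coeff m), ← mul_assoc, ← pow_add, ← abs_of_nonneg (hg m), abs_mul, abs_pow,
    abs_neg, abs_one, one_pow, one_mul]

end SignedGraph

theorem mainTheorem5 :
    -- the specialization `f` and the sink counting function `φ` exist
    (∃ f : signedPosetSpan →ₗ[ℚ] ℚ[X], IsChromaticSpecialization f) ∧
    (∃! φ : signedPosetSpan →ₗ[ℚ] ℚ[X], IsSinkCounting φ) ∧
    ∀ (V : Type*) (E : Type*) [Fintype V] [Finite E] (S : SignedGraph V E),
      ∃ hX : S.chromaticB ∈ signedPosetSpan,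
      ∃ χ : ℚ[X],
        -- `χ` is the signed chromatic polynomial
        S.IsSignedChromaticPolynomial χ ∧
        (∀ χ' : ℚ[X], S.IsSignedChromaticPolynomial χ' → χ' = χ) ∧
        -- `f` sends `X_Σ` to `χ`
        (∀ f : signedPosetSpan →ₗ[ℚ] ℚ[X], IsChromaticSpecialization f →
          f ⟨S.chromaticB, hX⟩ = χ) ∧
        -- comparison of `f` at `λ = -1` with `φ` at `t = 1`
        (∀ f φ : signedPosetSpan →ₗ[ℚ] ℚ[X],
          IsChromaticSpecialization f → IsSinkCounting φ →
          (f ⟨S.chromaticB, hX⟩).eval (-1) =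
              (-1) ^ Fintype.card V * (φ ⟨S.chromaticB, hX⟩).eval 1 ∧
          (φ ⟨S.chromaticB, hX⟩).eval 1 = (S.acyclicCount : ℚ)) ∧
        -- the value of the signed chromatic polynomial at `-1`
        χ.eval (-1) = (-1) ^ Fintype.card V * (S.acyclicCount : ℚ) ∧
        -- the coefficients of `X_Σ` in the p-basis
        ∃ g : MvPolynomial PIndex ℚ,
          MvPolynomial.aeval pBasis g = S.chromaticB ∧
          (∀ g' : MvPolynomial PIndex ℚ,
            MvPolynomial.aeval pBasis g' = S.chromaticB → g' = g) ∧
          ∑ m ∈ g.support, |g.coeff m| = (S.acyclicCount : ℚ) := by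
  obtain ⟨f₀, hf₀⟩ := exists_eval_eq_countFunctional
  have hf₀' := isChromaticSpecialization_of_countFunctional hf₀
  refine ⟨⟨f₀, hf₀'⟩, existsUnique_isSinkCounting, fun V E _ _ S => ?_⟩
  have := Fintype.ofFinite {P : S.Orientation // P.Acyclic}
  have hX := S.chromaticB_mem_signedPosetSpan
  have hsum : (⟨S.chromaticB, hX⟩ : signedPosetSpan) =
      ∑ P : {P : S.Orientation // P.Acyclic}, ⟨P.1.Y, P.1.Y_mem_signedPosetSpan P.2⟩ := by
    refine Subtype.ext ?_
    rw [AddSubmonoidClass.coe_finsetSum]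
    exact chromaticB_eq_sum
  obtain ⟨g, hg, hsign⟩ := S.exists_aeval_pBasis_eq_chromaticB
  have hfg : ∀ f : signedPosetSpan →ₗ[ℚ] ℚ[X], IsChromaticSpecialization f →
      f ⟨S.chromaticB, hX⟩ =
        MvPolynomial.aeval (fun i : PIndex => if i.isNone then (1 : ℚ[X]) else 2 * X + 1) g := by
    intro f hf
    obtain ⟨h, h'⟩ := hf.map_aeval_pBasis g
    rw [← h']
    exact congrArg f (Subtype.ext hg.symm)
  have hχ : S.IsSignedChromaticPolynomial (f₀ ⟨S.chromaticB, hX⟩) := by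
    intro l
    obtain ⟨N, hN⟩ := hf₀ ⟨S.chromaticB, hX⟩ l
    rw [← hN (max N (Fintype.card V)) (le_max_left _ _)]
    refine (countFunctional_formalSum _ Subtype.val_injective (le_max_right _ _)).trans ?_
    congr 1
    exact Nat.card_congr (Equiv.subtypeSubtypeEquivSubtypeInter S.IsProper
      fun κ => ∀ v, -(l : ℤ) ≤ κ v ∧ κ v ≤ l)
  have heval : (f₀ ⟨S.chromaticB, hX⟩).eval (-1) =
      (-1) ^ Fintype.card V * (S.acyclicCount : ℚ) := by
    rw [hsum, map_sum, eval_finsetSum, Finset.sum_congr rfl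
      (g := fun _ => (-1 : ℚ) ^ Fintype.card V), Finset.sum_const, nsmul_eq_mul, mul_comm,
      acyclicCount, Nat.card_eq_fintype_card, Finset.card_univ]
    intro P _
    rw [eval_eq_of_countFunctional hf₀ _ (P.1.orderPolynomial Finset.univ) (Fintype.card V)
      fun l N hN => countFunctional_Y P.1 hN,
      Orientation.orderPolynomial_neg_one P.2.peelable, Finset.card_univ]
  refine ⟨hX, f₀ ⟨S.chromaticB, hX⟩, hχ, fun χ' hχ' => ?_, fun f hf => ?_, fun f φ hf hφ => ?_,
    heval, g, hg, fun g' hg' => ?_, ?_⟩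
  · exact eq_of_forall_eval_natCast fun l => (hχ' l).trans (hχ l).symm
  · rw [hfg f hf, hfg f₀ hf₀']
  · have h1 : (φ ⟨S.chromaticB, hX⟩).eval 1 = (S.acyclicCount : ℚ) := by
      rw [hsum, map_sum, eval_finsetSum, Finset.sum_congr rfl fun P _ => hφ.eval_one_Y P.2,
        Finset.sum_const, nsmul_eq_mul, mul_one, acyclicCount, Nat.card_eq_fintype_card,
        Finset.card_univ]
    refine ⟨?_, h1⟩
    rw [h1, hfg f hf, ← hfg f₀ hf₀', heval]
  · exact algebraicIndependent_pBasis (hg'.trans hg.symm)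
  · rw [sum_abs_coeff_of_signsAlternate hsign, ← hfg f₀ hf₀', heval, ← mul_assoc, ← mul_pow]
    simp
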